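/- **The categories.** Let $\mathcal F^{triv}$ be the free symmetric monoidal category on one object $\ast$: its objects are the strings $\ast^{n}$, $n\ge 0$ (with the empty string as unit), its morphisms $\ast^n\to\ast^n$ are the permutations in $\mathbb S_n$, there are no morphisms between strings of different lengths, and $\otimes$ is concatenation. Its nc-plus construction $(\mathcal F^{triv})^{nc+}$ is the symmetric monoidal category with product $\boxtimes$ and unit $\varnothing$ whose objects are the words $\phi_1\boxtimes\dots\boxtimes\phi_k$ of morphisms of $\mathcal F^{triv}$ and whose morphisms are generated, as those of a symmetric monoidal category, by * isomorphisms $(\sigma\Downarrow\sigma')\colon\phi\to\sigma'\circ\phi\circ\sigma^{-1}$ for isomorphisms $\sigma,\sigma'$, * $\gamma_{\phi_1,\phi_0}\colon\phi_1\boxtimes\phi_0\to\phi_1\circ\phi_0$ for composable pairs, * $\mu_{\phi_1,\phi_2}\colon\phi_1\boxtimes\phi_2\to\phi_1\otimes\phi_2$, subject to: the isomorphisms compose as in $\mathcal F^{triv}$; $\gamma$ and $\mu$ are equivariant with respect to the isomorphisms; $\gamma$ is associative; $\mu$ is associative; and the interchange relation $\gamma\circ(\mu\boxtimes\mu)=\mu\circ(\gamma\boxtimes\gamma)\circ\tau_{23}$,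 with $\tau_{23}$ the exchange of the two middle factors. Each of the following features may or may not be added to the construction, independently of the others: * (a) generators $\varnothing\to\mathrm{id}_X$, one for every object $X$, invariant under the isomorphisms $(\sigma\Downarrow\sigma)$, which are two-sided units for $\gamma$ and are preserved by $\mu$; * (b) a generator $\varnothing\to\mathrm{id}_{\varnothing}$ (the identity of the empty string), which is a two-sided unit for $\mu$ and is respected by $\gamma$ (and equals the generator of (a) for $X=\varnothing$, if (a) is present); * (c) the relation that $\mu$ is compatible with the commutativity constraints of $\boxtimes$ and $\otimes$. **The structures.** Let $\mathcal C$ be a symmetric monoidal category with finite coproducts that are preserved by $\otimes$ in each variable, and give $\mathbb N$-graded objects of $\mathcal C$ the monoidal product $(A\bullet B)_n=\coprod_{p+q=n}A_p\otimes B_q$, whose unit is $1_{\mathcal C}$ in degree $0$ and initial in the other degrees. A *monoid object in symmetric sequences of $\mathcal C$-monoids* is a symmetric sequence $M=\{M(n)\}_{n\ge0}$ in $\mathcal C$ (an object $M(n)$ with an action of $\mathbb S_n$ for each $n$) with * an associative multiplication $\gamma_n\colon M(n)\otimes M(n)\to M(n)$ for each $n$, for which $\mathbb S_n$ acts by homomorphisms;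 * a morphism $M\bullet M\to M$, associative for $\bullet$, whose components $\mu_{p,q}\colon M(p)\otimes M(q)\to M(p+q)$ are $\mathbb S_p\times\mathbb S_q$-equivariant and respect the multiplications: $\gamma_{p+q}\circ(\mu_{p,q}\otimes\mu_{p,q})=\mu_{p,q}\circ(\gamma_p\otimes\gamma_q)\circ\tau_{23}$. In case (a) each $M(n)$ is moreover unital, with unit preserved by the action of $\mathbb S_n$ and by $\mu$. In case (b) $M$ is moreover unital for $\bullet$, with a unit $1\to M(0)$ that respects $\gamma_0$ (and the unit of $M(0)$, in case (a)). In case (c) $M$ is moreover commutative: $\mu_{p,q}$ followed by the block permutation $M(p+q)\to M(q+p)$ is $\mu_{q,p}$ composed with the symmetry of $\mathcal C$. Morphisms are the morphisms of symmetric sequences that respect all these structure maps. **Proposition.** For each choice of the optional features (a), (b), (c), $(\mathcal F^{triv})^{nc+}$ corepresents monoid objects in symmetric sequences of $\mathcal C$-monoids. Precisely, let $\mathcal O\colon(\mathcal F^{triv})^{nc+}\to\mathcal C$ be a strong symmetric monoidal functor. The objects $M_{\mathcal O}(n)=\mathcal O(\mathrm{id}_{\ast^{n}})$, with the action of $\mathbb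 S_n$ by $\mathcal O(\sigma\Downarrow\sigma)$, the multiplications given by the images of $\gamma\colon\mathrm{id}_{\ast^n}\boxtimes\mathrm{id}_{\ast^n}\to\mathrm{id}_{\ast^n}$, the morphism $M_{\mathcal O}\bullet M_{\mathcal O}\to M_{\mathcal O}$ assembled from the images of $\mu\colon\mathrm{id}_{\ast^p}\boxtimes\mathrm{id}_{\ast^q}\to\mathrm{id}_{\ast^{p+q}}$, and (where present) the units given by the images of the generators (a) and (b), form such a monoid object, and $\mathcal O\mapsto M_{\mathcal O}$ is an equivalence from the category of strong symmetric monoidal functors $(\mathcal F^{triv})^{nc+}\to\mathcal C$ and monoidal natural transformations to the category of these monoid objects. -/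

import Mathlib

open CategoryTheory MonoidalCategory Limits

universe v u v₁ u₁

noncomputable section

/-! ### The trivial Feynman category -/

/-- The trivial Feynman category, i.e. the free symmetric monoidal category on one object `∗`:
its objects are the strings `∗ ⊠ ⋯ ⊠ ∗`, recorded by their length. -/
structure FTriv : Type where
  /-- the length of the string -/
  len : ℕ

namespace FTriv

/-- The morphisms are the permutations of the letters; there are none between strings of
different lengths. -/
instance : Category FTriv where
  Hom X Y := Fin X.len ≃ Fin Y.len
  id X := Equiv.refl _
  comp f g := f.trans g

/-- The block sum of two permutations. -/
def blockSum {m n m' n' : ℕ} (f : Fin m ≃ Fin m') (g : Fin n ≃ Fin n') :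
    Fin (m + n) ≃ Fin (m' + n') :=
  finSumFinEquiv.symm.trans ((Equiv.sumCongr f g).trans finSumFinEquiv)

@[simp]
lemma blockSum_castAdd {m n m' n' : ℕ} (f : Fin m ≃ Fin m') (g : Fin n ≃ Fin n') (i : Fin m) :
    blockSum f g (Fin.castAdd n i) = Fin.castAdd n' (f i) := by
  simp [blockSum]

@[simp]
lemma blockSum_natAdd {m n m' n' : ℕ} (f : Fin m ≃ Fin m') (g : Fin n ≃ Fin n') (i : Fin n) :
    blockSum f g (Fin.natAdd m i) = Fin.natAdd m' (g i) := by
  simp [blockSum]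

/-- A permutation, as an isomorphism of `FTriv`. -/
def isoOfEquiv {X Y : FTriv} (e : Fin X.len ≃ Fin Y.len) : X ≅ Y where
  hom := e
  inv := e.symm
  hom_inv_id := e.self_trans_symm
  inv_hom_id := e.symm_trans_self

/-- Every morphism of `FTriv` is an isomorphism. -/
def toIso {X Y : FTriv} (f : X ⟶ Y) : X ≅ Y := isoOfEquiv f

/-- Concatenation of strings. -/
instance : MonoidalCategoryStruct FTriv where
  tensorObj X Y := ⟨X.len + Y.len⟩
  tensorUnit := ⟨0⟩
  tensorHom f g := blockSum f g
  whiskerLeft X _ _ g := blockSum (Equiv.refl (Fin X.len)) g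
  whiskerRight f Y := blockSum f (Equiv.refl (Fin Y.len))
  associator X Y Z := isoOfEquiv (finCongr (Nat.add_assoc X.len Y.len Z.len))
  leftUnitor X := isoOfEquiv (finCongr (Nat.zero_add X.len))
  rightUnitor X := isoOfEquiv (finCongr (Nat.add_zero X.len))

lemma blockSum_refl (m n : ℕ) :
    blockSum (Equiv.refl (Fin m)) (Equiv.refl (Fin n)) = Equiv.refl (Fin (m + n)) := by
  ext i
  induction i using Fin.addCases <;> simp

lemma blockSum_trans {m n m' n' m'' n'' : ℕ} (f : Fin m ≃ Fin m') (g : Fin n ≃ Fin n')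
    (f' : Fin m' ≃ Fin m'') (g' : Fin n' ≃ Fin n'') :
    (blockSum f g).trans (blockSum f' g') = blockSum (f.trans f') (g.trans g') := by
  ext i
  induction i using Fin.addCases <;> simp

lemma blockSum_finCongr {m n m' n' : ℕ} (h : m = m') (h' : n = n') :
    blockSum (finCongr h) (finCongr h') = finCongr (by rw [h, h']) := by
  subst h h'
  exact blockSum_refl _ _

lemma finCongr_add_assoc_castAdd {a b c : ℕ} (i : Fin (a + b)) :
    finCongr (Nat.add_assoc a b c) (Fin.castAdd c i) =
      Fin.addCases (fun j => Fin.castAdd (b + c) j)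
        (fun j => Fin.natAdd a (Fin.castAdd c j)) i := by
  induction i using Fin.addCases <;> (ext; simp)

lemma finCongr_add_assoc_natAdd {a b c : ℕ} (i : Fin c) :
    finCongr (Nat.add_assoc a b c) (Fin.natAdd (a + b) i) = Fin.natAdd a (Fin.natAdd b i) := by
  ext; simp [Nat.add_assoc]

lemma blockSum_assoc {a b c a' b' c' : ℕ} (f : Fin a ≃ Fin a') (g : Fin b ≃ Fin b')
    (h : Fin c ≃ Fin c') :
    (blockSum (blockSum f g) h).trans (finCongr (Nat.add_assoc a' b' c')) =
      (finCongr (Nat.add_assoc a b c)).trans (blockSum f (blockSum g h)) := by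
  refine Equiv.ext fun i => ?_
  simp only [Equiv.trans_apply]
  induction i using Fin.addCases with
  | left i =>
    rw [blockSum_castAdd, finCongr_add_assoc_castAdd, finCongr_add_assoc_castAdd]
    induction i using Fin.addCases <;> simp
  | right i =>
    rw [blockSum_natAdd, finCongr_add_assoc_natAdd, finCongr_add_assoc_natAdd]
    simp

lemma blockSum_zero_left {n n' : ℕ} (g : Fin n ≃ Fin n') :
    (blockSum (Equiv.refl (Fin 0)) g).trans (finCongr (Nat.zero_add n')) =
      (finCongr (Nat.zero_add n)).trans g := by
  refine Equiv.ext fun i => ?_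
  simp only [Equiv.trans_apply]
  induction i using Fin.addCases with
  | left i => exact i.elim0
  | right i =>
    rw [blockSum_natAdd]
    have h : ∀ (k : ℕ) (j : Fin k), finCongr (Nat.zero_add k) (Fin.natAdd 0 j) = j := by
      intro k j; ext; simp
    rw [h, h]

lemma blockSum_zero_right {n n' : ℕ} (g : Fin n ≃ Fin n') :
    (blockSum g (Equiv.refl (Fin 0))).trans (finCongr (Nat.add_zero n')) =
      (finCongr (Nat.add_zero n)).trans g := by
  refine Equiv.ext fun i => ?_
  simp only [Equiv.trans_apply]
  induction i using Fin.addCases with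
  | left i => rw [blockSum_castAdd]; rfl
  | right i => exact i.elim0

lemma blockSum_flip {m n m' n' : ℕ} (f : Fin m ≃ Fin m') (g : Fin n ≃ Fin n') :
    (blockSum f g).trans finAddFlip = finAddFlip.trans (blockSum g f) := by
  refine Equiv.ext fun i => ?_
  simp only [Equiv.trans_apply]
  induction i using Fin.addCases <;> simp

lemma flip_hexagon (a b c : ℕ) :
    (finCongr (Nat.add_assoc a b c)).trans
        ((finAddFlip : Fin (a + (b + c)) ≃ Fin (b + c + a)).trans
          (finCongr (Nat.add_assoc b c a))) =
      (blockSum (finAddFlip : Fin (a + b) ≃ Fin (b + a)) (Equiv.refl (Fin c))).trans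
        ((finCongr (Nat.add_assoc b a c)).trans
          (blockSum (Equiv.refl (Fin b)) (finAddFlip : Fin (a + c) ≃ Fin (c + a)))) := by
  refine Equiv.ext fun i => ?_
  simp only [Equiv.trans_apply]
  induction i using Fin.addCases with
  | left i =>
    rw [blockSum_castAdd, finCongr_add_assoc_castAdd, finCongr_add_assoc_castAdd]
    induction i using Fin.addCases with
    | left i => simp [finCongr_add_assoc_natAdd, -finCongr_apply]
    | right i => simp [finCongr_add_assoc_castAdd, -finCongr_apply]
  | right i =>
    rw [blockSum_natAdd, finCongr_add_assoc_natAdd]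
    simp [finCongr_add_assoc_castAdd, finCongr_add_assoc_natAdd, -finCongr_apply]

instance : MonoidalCategory FTriv := MonoidalCategory.ofTensorHom
  (id_tensorHom_id := fun X Y => blockSum_refl X.len Y.len)
  (id_tensorHom := fun _ _ _ _ => rfl)
  (tensorHom_id := fun _ _ => rfl)
  (tensorHom_comp_tensorHom := fun f₁ f₂ g₁ g₂ => blockSum_trans f₁ f₂ g₁ g₂)
  (associator_naturality := fun f g h => blockSum_assoc f g h)
  (leftUnitor_naturality := fun g => blockSum_zero_left g)
  (rightUnitor_naturality := fun g => blockSum_zero_right g)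
  (pentagon := fun W X Y Z => by
    have h₁ := blockSum_finCongr (Nat.add_assoc W.len X.len Y.len) (Eq.refl Z.len)
    have h₂ := blockSum_finCongr (Eq.refl W.len) (Nat.add_assoc X.len Y.len Z.len)
    refine (congrArg₂ (fun a b => Equiv.trans a (Equiv.trans _ b)) h₁ h₂).trans ?_
    exact Equiv.ext fun i => rfl)
  (triangle := fun X Y => by
    have h₁ := blockSum_finCongr (Nat.add_zero X.len) (Eq.refl Y.len)
    have h₂ := blockSum_finCongr (Eq.refl X.len) (Nat.zero_add Y.len)
    refine (congrArg (fun b => Equiv.trans _ b) h₂).trans (Eq.trans ?_ h₁.symm)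
    exact Equiv.ext fun i => rfl)

/-- The symmetry exchanges two blocks of letters. -/
instance : SymmetricCategory FTriv where
  braiding X Y := isoOfEquiv (finAddFlip : Fin (X.len + Y.len) ≃ Fin (Y.len + X.len))
  braiding_naturality_right X _ _ f := blockSum_flip (Equiv.refl (Fin X.len)) f
  braiding_naturality_left f Z := blockSum_flip f (Equiv.refl (Fin Z.len))
  hexagon_forward X Y Z := flip_hexagon X.len Y.len Z.len
  hexagon_reverse X Y Z := congrArg Equiv.symm (flip_hexagon Z.len X.len Y.len)
  symmetry X Y := (finAddFlip : Fin (X.len + Y.len) ≃ Fin (Y.len + X.len)).self_trans_symm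

end FTriv

/-! ### The nc-plus construction -/

/-- The three optional features of the nc-plus construction. With all of them switched off, its
only generators are the isomorphisms, the `γ`-morphisms and the `μ`-morphisms, and the symmetry of
the given category plays no role. -/
structure NCPlusOptions where
  /-- Adjoin units `∅ → id_X` for the `γ`-morphisms. -/
  γUnits : Bool
  /-- Adjoin a unit `∅ → id_1` for the `μ`-morphisms. -/
  μUnit : Bool
  /-- Require the `μ`-morphisms to be compatible with the commutativity constraints. -/
  symmetric : Bool

/-- Objects of the nc-plus construction of `M`: (bracketed) words `φ₁ ⊠ ⋯ ⊠ φₙ` of morphisms of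
`M`. Bracketings are kept, so that `⊠` has associators and unitors; they are coherent
isomorphisms by the relations below. -/
inductive NCPlus (o : NCPlusOptions) (M : Type u₁) [Category.{v₁} M] : Type (max u₁ v₁)
  | of {X Y : M} (φ : X ⟶ Y) : NCPlus o M
  | empty : NCPlus o M
  | box (A B : NCPlus o M) : NCPlus o M

namespace NCPlus

variable {o : NCPlusOptions} {M : Type u₁} [Category.{v₁} M] [MonoidalCategory M]
  [SymmetricCategory M]

/-- Formal composites and `⊠`-products of the structure morphisms of a symmetric monoidal category
and of the generators of the nc-plus construction. -/
inductive Hom : NCPlus o M → NCPlus o M → Type (max u₁ v₁)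
  | ident (A) : Hom A A
  | comp {A B C} (f : Hom A B) (g : Hom B C) : Hom A C
  | box {A B A' B'} (f : Hom A A') (g : Hom B B') : Hom (A.box B) (A'.box B')
  | assoc (A B C : NCPlus o M) : Hom ((A.box B).box C) (A.box (B.box C))
  | assocInv (A B C : NCPlus o M) : Hom (A.box (B.box C)) ((A.box B).box C)
  | left (A) : Hom (empty.box A) A
  | leftInv (A) : Hom A (empty.box A)
  | right (A : NCPlus o M) : Hom (A.box empty) A
  | rightInv (A : NCPlus o M) : Hom A (A.box empty)
  | swap (A B : NCPlus o M) : Hom (A.box B) (B.box A)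
  /-- The isomorphism `(σ ⇓ σ') : φ → σ' ∘ φ ∘ σ⁻¹`. -/
  | iso {X Y X' Y' : M} (φ : X ⟶ Y) (ψ : X' ⟶ Y') (σ : X ≅ X') (σ' : Y ≅ Y')
      (h : φ ≫ σ'.hom = σ.hom ≫ ψ) : Hom (of φ) (of ψ)
  /-- `γ : φ₁ ⊠ φ₀ → φ₁ ∘ φ₀` -/
  | γ {X Y Z : M} (φ₁ : Y ⟶ Z) (φ₀ : X ⟶ Y) : Hom ((of φ₁).box (of φ₀)) (of (φ₀ ≫ φ₁))
  /-- `μ : φ₁ ⊠ φ₂ → φ₁ ⊗ φ₂` -/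
  | μ {X₁ Y₁ X₂ Y₂ : M} (φ₁ : X₁ ⟶ Y₁) (φ₂ : X₂ ⟶ Y₂) :
      Hom ((of φ₁).box (of φ₂)) (of (φ₁ ⊗ₘ φ₂))
  /-- `∅ → id_X`, only present if units for `γ` are adjoined -/
  | γUnit (h : o.γUnits = true) (X : M) : Hom empty (of (𝟙 X))
  /-- `∅ → id_1`, only present if a unit for `μ` is adjoined -/
  | μUnit (h : o.μUnit = true) : Hom empty (of (𝟙 (𝟙_ M)))

namespace Hom

/-- The isomorphism `(id ⇓ id)` between two equal morphisms of `M`. -/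
def ofEq {X Y : M} {φ ψ : X ⟶ Y} (h : φ = ψ) : Hom (o := o) (of φ) (of ψ) :=
  iso φ ψ (Iso.refl X) (Iso.refl Y) (by simp [h])

/-- Exchange of the two middle factors of a fourfold `⊠`-product. -/
def middle (A B C D : NCPlus o M) :
    Hom ((A.box B).box (C.box D)) ((A.box C).box (B.box D)) :=
  (assoc A B (C.box D)).comp <|
    ((ident A).box (assocInv B C D)).comp <|
      ((ident A).box ((swap B C).box (ident D))).comp <|
        ((ident A).box (assoc C B D)).comp (assocInv A C (B.box D))

end Hom

open Hom in
/-- The relations between the morphisms of the nc-plus construction. -/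
inductive Rel : ∀ {A B : NCPlus o M}, Hom A B → Hom A B → Prop
  -- a congruence
  | refl {A B} (f : Hom A B) : Rel f f
  | symm {A B} {f g : Hom A B} : Rel f g → Rel g f
  | trans {A B} {f g h : Hom A B} : Rel f g → Rel g h → Rel f h
  | comp {A B C} {f f' : Hom A B} {g g' : Hom B C} :
      Rel f f' → Rel g g' → Rel (f.comp g) (f'.comp g')
  | box {A B A' B'} {f f' : Hom A A'} {g g' : Hom B B'} :
      Rel f f' → Rel g g' → Rel (f.box g) (f'.box g')
  -- the axioms of a symmetric monoidal category
  | id_comp {A B} (f : Hom A B) : Rel ((ident A).comp f) f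
  | comp_id {A B} (f : Hom A B) : Rel (f.comp (ident B)) f
  | comp_assoc {A B C D} (f : Hom A B) (g : Hom B C) (h : Hom C D) :
      Rel ((f.comp g).comp h) (f.comp (g.comp h))
  | box_id (A B) : Rel ((ident A).box (ident B)) (ident (A.box B))
  | box_comp {A B C A' B' C'} (f : Hom A B) (f' : Hom A' B') (g : Hom B C) (g' : Hom B' C') :
      Rel ((f.box f').comp (g.box g')) ((f.comp g).box (f'.comp g'))
  | assoc_assocInv (A B C) : Rel ((assoc A B C).comp (assocInv A B C)) (ident _)
  | assocInv_assoc (A B C) : Rel ((assocInv A B C).comp (assoc A B C)) (ident _)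
  | assoc_natural {A B C A' B' C'} (f : Hom A A') (g : Hom B B') (h : Hom C C') :
      Rel (((f.box g).box h).comp (assoc A' B' C')) ((assoc A B C).comp (f.box (g.box h)))
  | left_leftInv (A) : Rel ((left A).comp (leftInv A)) (ident _)
  | leftInv_left (A) : Rel ((leftInv A).comp (left A)) (ident _)
  | left_natural {A B} (f : Hom A B) : Rel (((ident empty).box f).comp (left B)) ((left A).comp f)
  | right_rightInv (A) : Rel ((right A).comp (rightInv A)) (ident _)
  | rightInv_right (A) : Rel ((rightInv A).comp (right A)) (ident _)
  | right_natural {A B} (f : Hom A B) : Rel ((f.box (ident empty)).comp (right B)) ((right A).comp f)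
  | pentagon (A B C D) :
      Rel (((assoc A B C).box (ident D)).comp
          ((assoc A (B.box C) D).comp ((ident A).box (assoc B C D))))
        ((assoc (A.box B) C D).comp (assoc A B (C.box D)))
  | triangle (A B) :
      Rel ((assoc A empty B).comp ((ident A).box (left B))) ((right A).box (ident B))
  | swap_natural {A B A' B'} (f : Hom A A') (g : Hom B B') :
      Rel ((f.box g).comp (swap A' B')) ((swap A B).comp (g.box f))
  | swap_swap (A B) : Rel ((swap A B).comp (swap B A)) (ident _)
  | hexagon (A B C) :
      Rel ((assoc A B C).comp ((swap A (B.box C)).comp (assoc B C A)))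
        (((swap A B).box (ident C)).comp ((assoc B A C).comp ((ident B).box (swap A C))))
  -- the isomorphisms compose as in `M`
  | iso_refl {X Y : M} (φ : X ⟶ Y) : Rel (ofEq (rfl : φ = φ)) (ident (of φ))
  | iso_trans {X Y X' Y' X'' Y'' : M} (φ : X ⟶ Y) (φ' : X' ⟶ Y') (φ'' : X'' ⟶ Y'')
      (σ : X ≅ X') (σ' : Y ≅ Y') (τ : X' ≅ X'') (τ' : Y' ≅ Y'')
      (h : φ ≫ σ'.hom = σ.hom ≫ φ') (h' : φ' ≫ τ'.hom = τ.hom ≫ φ'')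
      (h'' : φ ≫ (σ' ≪≫ τ').hom = (σ ≪≫ τ).hom ≫ φ'') :
      Rel ((iso φ φ' σ σ' h).comp (iso φ' φ'' τ τ' h')) (iso φ φ'' (σ ≪≫ τ) (σ' ≪≫ τ') h'')
  -- inner and outer equivariance of `γ`
  | γ_equivariant {X Y Z X' Y' Z' : M} (φ₁ : Y ⟶ Z) (φ₀ : X ⟶ Y) (ψ₁ : Y' ⟶ Z') (ψ₀ : X' ⟶ Y')
      (σ : X ≅ X') (τ : Y ≅ Y') (σ' : Z ≅ Z')
      (h₁ : φ₁ ≫ σ'.hom = τ.hom ≫ ψ₁) (h₀ : φ₀ ≫ τ.hom = σ.hom ≫ ψ₀)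
      (h : (φ₀ ≫ φ₁) ≫ σ'.hom = σ.hom ≫ ψ₀ ≫ ψ₁) :
      Rel ((γ φ₁ φ₀).comp (iso (φ₀ ≫ φ₁) (ψ₀ ≫ ψ₁) σ σ' h))
        (((iso φ₁ ψ₁ τ σ' h₁).box (iso φ₀ ψ₀ σ τ h₀)).comp (γ ψ₁ ψ₀))
  -- associativity of `γ`
  | γ_assoc {W X Y Z : M} (φ₂ : Y ⟶ Z) (φ₁ : X ⟶ Y) (φ₀ : W ⟶ X) :
      Rel (((γ φ₂ φ₁).box (ident (of φ₀))).comp (γ (φ₁ ≫ φ₂) φ₀))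
        ((assoc (of φ₂) (of φ₁) (of φ₀)).comp (((ident (of φ₂)).box (γ φ₁ φ₀)).comp
          ((γ φ₂ (φ₀ ≫ φ₁)).comp (ofEq (Category.assoc φ₀ φ₁ φ₂)))))
  -- equivariance of `μ`
  | μ_equivariant {X₁ Y₁ X₂ Y₂ X₁' Y₁' X₂' Y₂' : M} (φ₁ : X₁ ⟶ Y₁) (φ₂ : X₂ ⟶ Y₂)
      (ψ₁ : X₁' ⟶ Y₁') (ψ₂ : X₂' ⟶ Y₂')
      (σ₁ : X₁ ≅ X₁') (σ₁' : Y₁ ≅ Y₁') (σ₂ : X₂ ≅ X₂') (σ₂' : Y₂ ≅ Y₂')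
      (h₁ : φ₁ ≫ σ₁'.hom = σ₁.hom ≫ ψ₁) (h₂ : φ₂ ≫ σ₂'.hom = σ₂.hom ≫ ψ₂)
      (h : (φ₁ ⊗ₘ φ₂) ≫ (σ₁' ⊗ᵢ σ₂').hom = (σ₁ ⊗ᵢ σ₂).hom ≫ (ψ₁ ⊗ₘ ψ₂)) :
      Rel ((μ φ₁ φ₂).comp (iso (φ₁ ⊗ₘ φ₂) (ψ₁ ⊗ₘ ψ₂) (σ₁ ⊗ᵢ σ₂) (σ₁' ⊗ᵢ σ₂') h))
        (((iso φ₁ ψ₁ σ₁ σ₁' h₁).box (iso φ₂ ψ₂ σ₂ σ₂' h₂)).comp (μ ψ₁ ψ₂))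
  -- associativity of `μ`
  | μ_assoc {X₁ Y₁ X₂ Y₂ X₃ Y₃ : M} (φ₁ : X₁ ⟶ Y₁) (φ₂ : X₂ ⟶ Y₂) (φ₃ : X₃ ⟶ Y₃) :
      Rel (((μ φ₁ φ₂).box (ident (of φ₃))).comp ((μ (φ₁ ⊗ₘ φ₂) φ₃).comp
          (iso ((φ₁ ⊗ₘ φ₂) ⊗ₘ φ₃) (φ₁ ⊗ₘ (φ₂ ⊗ₘ φ₃)) (α_ X₁ X₂ X₃) (α_ Y₁ Y₂ Y₃)
            (associator_naturality φ₁ φ₂ φ₃))))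
        ((assoc (of φ₁) (of φ₂) (of φ₃)).comp
          (((ident (of φ₁)).box (μ φ₂ φ₃)).comp (μ φ₁ (φ₂ ⊗ₘ φ₃))))
  -- interchange of `γ` and `μ`
  | interchange {X Y Z X' Y' Z' : M} (φ₁ : Y ⟶ Z) (φ₀ : X ⟶ Y) (ψ₁ : Y' ⟶ Z') (ψ₀ : X' ⟶ Y') :
      Rel (((μ φ₁ ψ₁).box (μ φ₀ ψ₀)).comp ((γ (φ₁ ⊗ₘ ψ₁) (φ₀ ⊗ₘ ψ₀)).comp
          (ofEq (tensorHom_comp_tensorHom φ₀ ψ₀ φ₁ ψ₁))))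
        ((middle (of φ₁) (of ψ₁) (of φ₀) (of ψ₀)).comp
          (((γ φ₁ φ₀).box (γ ψ₁ ψ₀)).comp (μ (φ₀ ≫ φ₁) (ψ₀ ≫ ψ₁))))
  -- compatibility of `μ` with the commutativity constraints (optional)
  | μ_symmetric (_ : o.symmetric = true) {X₁ Y₁ X₂ Y₂ : M} (φ₁ : X₁ ⟶ Y₁) (φ₂ : X₂ ⟶ Y₂) :
      Rel ((μ φ₁ φ₂).comp (iso (φ₁ ⊗ₘ φ₂) (φ₂ ⊗ₘ φ₁) (β_ X₁ X₂) (β_ Y₁ Y₂)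
          (BraidedCategory.braiding_naturality φ₁ φ₂)))
        ((swap (of φ₁) (of φ₂)).comp (μ φ₂ φ₁))
  -- units for `γ` (optional): they are invariant, they are units, and `μ` respects them
  | γUnit_iso (hu : o.γUnits = true) {X Y : M} (σ : X ≅ Y) (h : 𝟙 X ≫ σ.hom = σ.hom ≫ 𝟙 Y) :
      Rel ((γUnit hu X).comp (iso (𝟙 X) (𝟙 Y) σ σ h)) (γUnit hu Y)
  | γUnit_left (hu : o.γUnits = true) {X Y : M} (φ : X ⟶ Y) :
      Rel (((γUnit hu Y).box (ident (of φ))).comp ((γ (𝟙 Y) φ).comp (ofEq (Category.comp_id φ))))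
        (left (of φ))
  | γUnit_right (hu : o.γUnits = true) {X Y : M} (φ : X ⟶ Y) :
      Rel (((ident (of φ)).box (γUnit hu X)).comp ((γ φ (𝟙 X)).comp (ofEq (Category.id_comp φ))))
        (right (of φ))
  | μ_γUnit (hu : o.γUnits = true) (X Y : M) :
      Rel (((γUnit hu X).box (γUnit hu Y)).comp
          ((μ (𝟙 X) (𝟙 Y)).comp (ofEq (id_tensorHom_id X Y))))
        ((left empty).comp (γUnit hu (X ⊗ Y)))
  -- unit for `μ` (optional): it is a unit, and it respects `γ` and the units for `γ`, if any
  | μUnit_left (hu : o.μUnit = true) {X Y : M} (φ : X ⟶ Y)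
      (h : (𝟙 (𝟙_ M) ⊗ₘ φ) ≫ (λ_ Y).hom = (λ_ X).hom ≫ φ) :
      Rel (((μUnit hu).box (ident (of φ))).comp
          ((μ (𝟙 (𝟙_ M)) φ).comp (iso (𝟙 (𝟙_ M) ⊗ₘ φ) φ (λ_ X) (λ_ Y) h)))
        (left (of φ))
  | μUnit_right (hu : o.μUnit = true) {X Y : M} (φ : X ⟶ Y)
      (h : (φ ⊗ₘ 𝟙 (𝟙_ M)) ≫ (ρ_ Y).hom = (ρ_ X).hom ≫ φ) :
      Rel (((ident (of φ)).box (μUnit hu)).comp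
          ((μ φ (𝟙 (𝟙_ M))).comp (iso (φ ⊗ₘ 𝟙 (𝟙_ M)) φ (ρ_ X) (ρ_ Y) h)))
        (right (of φ))
  | γ_μUnit (hu : o.μUnit = true) :
      Rel (((μUnit hu).box (μUnit hu)).comp
          ((γ (𝟙 (𝟙_ M)) (𝟙 (𝟙_ M))).comp (ofEq (Category.comp_id (𝟙 (𝟙_ M))))))
        ((left empty).comp (μUnit hu))
  | μUnit_eq_γUnit (hu : o.γUnits = true) (hu' : o.μUnit = true) :
      Rel (μUnit hu') (γUnit hu (𝟙_ M))

/-- Morphisms of the nc-plus construction are formal morphisms modulo the relations. -/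
instance homSetoid (A B : NCPlus o M) : Setoid (Hom A B) :=
  ⟨Rel, ⟨Rel.refl, Rel.symm, Rel.trans⟩⟩

instance : Category (NCPlus o M) where
  Hom A B := Quotient (homSetoid A B)
  id A := ⟦Hom.ident A⟧
  comp := Quotient.map₂ Hom.comp (fun _ _ hf _ _ hg => Rel.comp hf hg)
  id_comp := by
    rintro _ _ ⟨f⟩
    exact Quotient.sound (Rel.id_comp f)
  comp_id := by
    rintro _ _ ⟨f⟩
    exact Quotient.sound (Rel.comp_id f)
  assoc := by
    rintro _ _ _ _ ⟨f⟩ ⟨g⟩ ⟨h⟩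
    exact Quotient.sound (Rel.comp_assoc f g h)

/-- The class of a formal morphism. -/
def mk {A B : NCPlus o M} (f : Hom A B) : A ⟶ B := Quotient.mk (homSetoid A B) f

/-- The `⊠`-product of morphisms. -/
def boxHom {A B A' B' : NCPlus o M} (f : A ⟶ A') (g : B ⟶ B') : A.box B ⟶ A'.box B' :=
  Quotient.map₂ Hom.box (fun _ _ hf _ _ hg => Rel.box hf hg) f g

instance : MonoidalCategoryStruct (NCPlus o M) where
  tensorObj := box
  tensorUnit := empty
  tensorHom := boxHom
  whiskerLeft A _ _ g := boxHom (𝟙 A) g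
  whiskerRight f B := boxHom f (𝟙 B)
  associator A B C :=
    ⟨mk (.assoc A B C), mk (.assocInv A B C), Quotient.sound (.assoc_assocInv A B C),
      Quotient.sound (.assocInv_assoc A B C)⟩
  leftUnitor A :=
    ⟨mk (.left A), mk (.leftInv A), Quotient.sound (.left_leftInv A),
      Quotient.sound (.leftInv_left A)⟩
  rightUnitor A :=
    ⟨mk (.right A), mk (.rightInv A), Quotient.sound (.right_rightInv A),
      Quotient.sound (.rightInv_right A)⟩

instance : MonoidalCategory (NCPlus o M) := MonoidalCategory.ofTensorHom
  (id_tensorHom_id := fun A B => Quotient.sound (Rel.box_id A B))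
  (id_tensorHom := fun _ _ _ _ => rfl)
  (tensorHom_id := fun _ _ => rfl)
  (tensorHom_comp_tensorHom := by
    rintro _ _ _ _ _ _ ⟨f⟩ ⟨f'⟩ ⟨g⟩ ⟨g'⟩
    exact Quotient.sound (Rel.box_comp f f' g g'))
  (associator_naturality := by
    rintro _ _ _ _ _ _ ⟨f⟩ ⟨g⟩ ⟨h⟩
    exact Quotient.sound (Rel.assoc_natural f g h))
  (leftUnitor_naturality := by
    rintro _ _ ⟨f⟩
    exact Quotient.sound (Rel.left_natural f))
  (rightUnitor_naturality := by
    rintro _ _ ⟨f⟩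
    exact Quotient.sound (Rel.right_natural f))
  (pentagon := fun A B C D => Quotient.sound (Rel.pentagon A B C D))
  (triangle := fun A B => Quotient.sound (Rel.triangle A B))

/-- The commutativity constraint of `⊠`. -/
def swapIso (A B : NCPlus o M) : A ⊗ B ≅ B ⊗ A :=
  ⟨mk (.swap A B), mk (.swap B A), Quotient.sound (.swap_swap A B), Quotient.sound (.swap_swap B A)⟩

lemma swapIso_hexagon (A B C : NCPlus o M) :
    (α_ A B C).hom ≫ (swapIso A (B ⊗ C)).hom ≫ (α_ B C A).hom =
      (swapIso A B).hom ▷ C ≫ (α_ B A C).hom ≫ B ◁ (swapIso A C).hom :=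
  Quotient.sound (Rel.hexagon A B C)

instance : SymmetricCategory (NCPlus o M) where
  braiding := swapIso
  braiding_naturality_right A _ _ := by
    rintro ⟨f⟩
    exact Quotient.sound (Rel.swap_natural (Hom.ident A) f)
  braiding_naturality_left := by
    rintro _ _ ⟨f⟩ B
    exact Quotient.sound (Rel.swap_natural f (Hom.ident B))
  hexagon_forward := swapIso_hexagon
  hexagon_reverse A B C := by
    have h : α_ C A B ≪≫ swapIso C (A ⊗ B) ≪≫ α_ A B C =
        whiskerRightIso (swapIso C A) B ≪≫ α_ A C B ≪≫ whiskerLeftIso A (swapIso C B) :=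
      Iso.ext (swapIso_hexagon C A B)
    have h' := congrArg Iso.inv h
    simp only [Iso.trans_inv, Category.assoc, whiskerRightIso_inv, whiskerLeftIso_inv] at h'
    exact h'
  symmetry A B := Quotient.sound (Rel.swap_swap A B)

end NCPlus

/-! ### Strong symmetric monoidal functors -/

/-- Strong symmetric monoidal functors from `A` to `C`. -/
structure StrongSymmFunctor (A : Type u₁) [Category.{v₁} A] [MonoidalCategory A]
    [SymmetricCategory A] (C : Type u) [Category.{v} C] [MonoidalCategory C]
    [SymmetricCategory C] where
  /-- the underlying functor -/
  functor : A ⥤ C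
  /-- the strong symmetric monoidal structure -/
  braided : functor.Braided

namespace StrongSymmFunctor

attribute [instance] braided

variable {A : Type u₁} [Category.{v₁} A] [MonoidalCategory A] [SymmetricCategory A]
  {C : Type u} [Category.{v} C] [MonoidalCategory C] [SymmetricCategory C]

/-- Monoidal natural transformations. -/
@[ext]
structure Hom (F G : StrongSymmFunctor A C) where
  /-- the underlying natural transformation -/
  natTrans : F.functor ⟶ G.functor
  isMonoidal : NatTrans.IsMonoidal natTrans

attribute [instance] Hom.isMonoidal

instance : Category (StrongSymmFunctor A C) where
  Hom := Hom
  id F := ⟨𝟙 F.functor, inferInstance⟩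
  comp f g := ⟨f.natTrans ≫ g.natTrans, inferInstance⟩

end StrongSymmFunctor

/-! ### Monoid objects in symmetric sequences of monoids -/

section Target

open GradedObject

variable (o : NCPlusOptions) (C : Type u) [Category.{v} C] [MonoidalCategory C]
  [SymmetricCategory C] [HasFiniteCoproducts C]
  [∀ X : C, PreservesFiniteCoproducts (tensorLeft X)]

/-- A symmetric sequence in `C`, i.e. objects `M(n)` with an action of the symmetric group on `n`
letters. -/
abbrev SymmSeq := FTriv ⥤ C

variable {C}

/-- The graded object underlying a symmetric sequence. -/
def SymmSeq.graded (M : SymmSeq C) : GradedObject ℕ C := fun n => M.obj ⟨n⟩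

/-- The morphism of graded objects underlying a morphism of symmetric sequences. -/
def SymmSeq.gradedMap {M N : SymmSeq C} (f : M ⟶ N) : M.graded ⟶ N.graded := fun n => f.app ⟨n⟩

/-- The morphism `M ⊗ M ⟶ M` of graded objects assembled from a family of morphisms
`M(p) ⊗ M(q) ⟶ M(p + q)`. -/
def SymmSeq.gradedMul (M : SymmSeq C)
    (m : ∀ p q : ℕ, M.obj ⟨p⟩ ⊗ M.obj ⟨q⟩ ⟶ M.obj ⟨p + q⟩) : M.graded ⊗ M.graded ⟶ M.graded :=
  fun _ => Monoidal.tensorObjDesc fun p q h => m p q ≫ eqToHom (by subst h; rfl)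

/-- The morphism `𝟙_ ⟶ M` of graded objects given by a morphism `𝟙_ C ⟶ M(0)`. -/
def SymmSeq.gradedOne (M : SymmSeq C) (e : 𝟙_ C ⟶ M.obj ⟨0⟩) :
    𝟙_ (GradedObject ℕ C) ⟶ M.graded
  | 0 => Monoidal.tensorUnit₀.hom ≫ e
  | n + 1 => (Monoidal.isInitialTensorUnitApply (n + 1) n.succ_ne_zero).to _

lemma SymmSeq.ι_gradedMul (M : SymmSeq C)
    (m : ∀ p q : ℕ, M.obj ⟨p⟩ ⊗ M.obj ⟨q⟩ ⟶ M.obj ⟨p + q⟩) (p q : ℕ) :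
    Monoidal.ιTensorObj M.graded M.graded p q (p + q) rfl ≫ M.gradedMul m (p + q) = m p q :=
  (Monoidal.ι_tensorObjDesc _ p q rfl).trans (Category.comp_id _)

lemma SymmSeq.gradedMul_comp {M N : SymmSeq C} (f : M ⟶ N)
    (m : ∀ p q : ℕ, M.obj ⟨p⟩ ⊗ M.obj ⟨q⟩ ⟶ M.obj ⟨p + q⟩)
    (m' : ∀ p q : ℕ, N.obj ⟨p⟩ ⊗ N.obj ⟨q⟩ ⟶ N.obj ⟨p + q⟩)
    (h : ∀ p q, m p q ≫ f.app ⟨p + q⟩ = (f.app ⟨p⟩ ⊗ₘ f.app ⟨q⟩) ≫ m' p q) :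
    M.gradedMul m ≫ SymmSeq.gradedMap f =
      (SymmSeq.gradedMap f ⊗ₘ SymmSeq.gradedMap f) ≫ N.gradedMul m' := by
  funext n
  refine Monoidal.tensorObj_ext _ _ fun p q hpq => ?_
  subst hpq
  have h₁ := SymmSeq.ι_gradedMul M m p q
  have h₂ := SymmSeq.ι_gradedMul N m' p q
  have h₃ := Monoidal.ι_tensorHom (SymmSeq.gradedMap f) (SymmSeq.gradedMap f) p q (p + q) rfl
  refine (Category.assoc _ _ _).symm.trans ?_
  refine Eq.trans (congrArg (· ≫ f.app ⟨p + q⟩) h₁) ?_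
  refine Eq.trans (h p q) ?_
  refine Eq.trans (congrArg ((f.app ⟨p⟩ ⊗ₘ f.app ⟨q⟩) ≫ ·) h₂.symm) ?_
  refine (Category.assoc _ _ _).symm.trans ?_
  exact (congrArg (· ≫ N.gradedMul m' (p + q)) h₃.symm).trans (Category.assoc _ _ _)

lemma SymmSeq.gradedOne_comp {M N : SymmSeq C} (f : M ⟶ N) (e : 𝟙_ C ⟶ M.obj ⟨0⟩)
    (e' : 𝟙_ C ⟶ N.obj ⟨0⟩) (h : e ≫ f.app ⟨0⟩ = e') :
    M.gradedOne e ≫ SymmSeq.gradedMap f = N.gradedOne e' := by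
  funext n
  cases n with
  | zero =>
    refine (Category.assoc _ _ _).trans ?_
    exact congrArg (Monoidal.tensorUnit₀.hom ≫ ·) h
  | succ n => exact (Monoidal.isInitialTensorUnitApply (n + 1) n.succ_ne_zero).hom_ext _ _

variable (C)

/-- The structure maps (without any axiom) of a monoid object in the category of symmetric
sequences of monoids in `C`. The tensor product of `ℕ`-graded objects is
`(A ⊗ B) n = ∐ (p + q = n), A p ⊗ B q`; its unit is `𝟙_ C` in degree `0` and initial in the other
degrees. -/
structure SymmSeqData where
  /-- the symmetric sequence -/
  M : SymmSeq C
  /-- the multiplication of each `M(n)` -/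
  γ (n : ℕ) : M.obj ⟨n⟩ ⊗ M.obj ⟨n⟩ ⟶ M.obj ⟨n⟩
  /-- the unit of each `M(n)` -/
  γUnit (h : o.γUnits = true) (n : ℕ) : 𝟙_ C ⟶ M.obj ⟨n⟩
  /-- the multiplication of `M` -/
  mul : M.graded ⊗ M.graded ⟶ M.graded
  /-- the unit of `M` -/
  one (h : o.μUnit = true) : 𝟙_ (GradedObject ℕ C) ⟶ M.graded

namespace SymmSeqData

variable {o C}

/-- Morphisms of symmetric sequences that respect the structure maps. -/
@[ext]
structure Hom (D E : SymmSeqData o C) where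
  /-- the morphism of symmetric sequences -/
  f : D.M ⟶ E.M
  γ_comp (n : ℕ) : D.γ n ≫ f.app ⟨n⟩ = (f.app ⟨n⟩ ⊗ₘ f.app ⟨n⟩) ≫ E.γ n
  γUnit_comp (h : o.γUnits = true) (n : ℕ) : D.γUnit h n ≫ f.app ⟨n⟩ = E.γUnit h n
  mul_comp : D.mul ≫ SymmSeq.gradedMap f =
    (SymmSeq.gradedMap f ⊗ₘ SymmSeq.gradedMap f) ≫ E.mul
  one_comp (h : o.μUnit = true) : D.one h ≫ SymmSeq.gradedMap f = E.one h

instance : Category (SymmSeqData o C) where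
  Hom := Hom
  id D :=
    { f := 𝟙 D.M
      γ_comp := fun n => by simp
      γUnit_comp := fun h n => by simp
      mul_comp := by
        have h : SymmSeq.gradedMap (𝟙 D.M) = 𝟙 D.M.graded := rfl
        rw [h, Category.comp_id, id_tensorHom_id, Category.id_comp]
      one_comp := fun h => Category.comp_id _ }
  comp {D E F} f g :=
    { f := f.f ≫ g.f
      γ_comp := fun n => by
        rw [NatTrans.comp_app, ← Category.assoc, f.γ_comp, Category.assoc, g.γ_comp,
          ← Category.assoc, tensorHom_comp_tensorHom]
      γUnit_comp := fun h n => by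
        rw [NatTrans.comp_app, ← Category.assoc, f.γUnit_comp, g.γUnit_comp]
      mul_comp := by
        have h : SymmSeq.gradedMap (f.f ≫ g.f) =
          SymmSeq.gradedMap f.f ≫ SymmSeq.gradedMap g.f := rfl
        rw [h, ← Category.assoc, f.mul_comp, Category.assoc, g.mul_comp,
          ← Category.assoc, tensorHom_comp_tensorHom]
      one_comp := fun h => by
        have h' : SymmSeq.gradedMap (f.f ≫ g.f) =
          SymmSeq.gradedMap f.f ≫ SymmSeq.gradedMap g.f := rfl
        rw [h', ← Category.assoc, f.one_comp, g.one_comp] }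

/-- The component `M(p) ⊗ M(q) → M(p + q)` of the multiplication of `M`. -/
def μ (D : SymmSeqData o C) (p q : ℕ) : D.M.obj ⟨p⟩ ⊗ D.M.obj ⟨q⟩ ⟶ D.M.obj ⟨p + q⟩ :=
  Monoidal.ιTensorObj D.M.graded D.M.graded p q (p + q) rfl ≫ D.mul (p + q)

/-- The component `1 → M(0)` of the unit of `M`. -/
def η (D : SymmSeqData o C) (h : o.μUnit = true) : 𝟙_ C ⟶ D.M.obj ⟨0⟩ :=
  Monoidal.tensorUnit₀.inv ≫ D.one h 0

/-- The axioms of a monoid object in the category of symmetric sequences of monoids in `C`. -/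
structure IsMonoid (D : SymmSeqData o C) : Prop where
  /-- each `M(n)` is associative -/
  γ_assoc (n : ℕ) : D.γ n ▷ D.M.obj ⟨n⟩ ≫ D.γ n =
    (α_ _ _ _).hom ≫ D.M.obj ⟨n⟩ ◁ D.γ n ≫ D.γ n
  /-- each `M(n)` is unital -/
  γUnit_left (h : o.γUnits = true) (n : ℕ) : D.γUnit h n ▷ D.M.obj ⟨n⟩ ≫ D.γ n = (λ_ _).hom
  γUnit_right (h : o.γUnits = true) (n : ℕ) : D.M.obj ⟨n⟩ ◁ D.γUnit h n ≫ D.γ n = (ρ_ _).hom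
  /-- the symmetric group acts on `M(n)` by homomorphisms of monoids -/
  γ_equivariant (n : ℕ) (σ : (⟨n⟩ : FTriv) ⟶ ⟨n⟩) :
    D.γ n ≫ D.M.map σ = (D.M.map σ ⊗ₘ D.M.map σ) ≫ D.γ n
  γUnit_equivariant (h : o.γUnits = true) (n : ℕ) (σ : (⟨n⟩ : FTriv) ⟶ ⟨n⟩) :
    D.γUnit h n ≫ D.M.map σ = D.γUnit h n
  /-- `M` is associative for the tensor product of graded objects -/
  mul_assoc : D.mul ▷ D.M.graded ≫ D.mul = (α_ _ _ _).hom ≫ D.M.graded ◁ D.mul ≫ D.mul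
  /-- `M` is unital for the tensor product of graded objects -/
  one_left (h : o.μUnit = true) : D.one h ▷ D.M.graded ≫ D.mul = (λ_ _).hom
  one_right (h : o.μUnit = true) : D.M.graded ◁ D.one h ≫ D.mul = (ρ_ _).hom
  /-- the multiplication of `M` is equivariant -/
  μ_equivariant (p q : ℕ) (σ : (⟨p⟩ : FTriv) ⟶ ⟨p⟩) (τ : (⟨q⟩ : FTriv) ⟶ ⟨q⟩) :
    D.μ p q ≫ D.M.map (show (⟨p + q⟩ : FTriv) ⟶ ⟨p + q⟩ from σ ⊗ₘ τ) =
      (D.M.map σ ⊗ₘ D.M.map τ) ≫ D.μ p q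
  /-- the multiplication of `M` respects the multiplications of the `M(n)` -/
  interchange (p q : ℕ) : (D.μ p q ⊗ₘ D.μ p q) ≫ D.γ (p + q) =
    tensorμ (D.M.obj ⟨p⟩) (D.M.obj ⟨q⟩) (D.M.obj ⟨p⟩) (D.M.obj ⟨q⟩) ≫
      (D.γ p ⊗ₘ D.γ q) ≫ D.μ p q
  /-- the multiplication of `M` respects the units of the `M(n)` -/
  μ_γUnit (h : o.γUnits = true) (p q : ℕ) :
    (D.γUnit h p ⊗ₘ D.γUnit h q) ≫ D.μ p q = (λ_ _).hom ≫ D.γUnit h (p + q)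
  /-- the unit of `M` respects the multiplication of `M(0)` -/
  γ_η (h : o.μUnit = true) : (D.η h ⊗ₘ D.η h) ≫ D.γ 0 = (λ_ _).hom ≫ D.η h
  /-- the unit of `M` respects the unit of `M(0)` -/
  η_eq_γUnit (h : o.γUnits = true) (h' : o.μUnit = true) : D.η h' = D.γUnit h 0
  /-- `M` is commutative, if the symmetric version is considered -/
  commutative (h : o.symmetric = true) (p q : ℕ) :
    D.μ p q ≫ D.M.map (show (⟨p + q⟩ : FTriv) ⟶ ⟨q + p⟩ from (β_ (⟨p⟩ : FTriv) ⟨q⟩).hom) =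
      (β_ _ _).hom ≫ D.μ q p

/-- As a property of objects. -/
def isMonoid : ObjectProperty (SymmSeqData o C) := IsMonoid

end SymmSeqData

/-! ### From functors on the nc-plus construction to symmetric sequences -/

namespace NCPlus

/-- The basic object `id_{∗ⁿ}`, and the action `σ ↦ (σ ⇓ σ)` of the permutations on it. -/
def idFunctor : FTriv ⥤ NCPlus o FTriv where
  obj X := of (𝟙 X)
  map {X Y} σ := mk (.iso (𝟙 X) (𝟙 Y) (FTriv.toIso σ) (FTriv.toIso σ)
    ((Category.id_comp _).trans (Category.comp_id _).symm))
  map_id X := Quotient.sound (Rel.iso_refl (𝟙 X))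
  map_comp {X Y Z} σ τ := Quotient.sound <|
    Rel.symm (Rel.iso_trans (𝟙 X) (𝟙 Y) (𝟙 Z) (FTriv.toIso σ) (FTriv.toIso σ)
      (FTriv.toIso τ) (FTriv.toIso τ) _ _ _)

/-- `γ : id_{∗ⁿ} ⊠ id_{∗ⁿ} → id_{∗ⁿ}` -/
def gamma (n : ℕ) : (idFunctor o).obj ⟨n⟩ ⊗ (idFunctor o).obj ⟨n⟩ ⟶ (idFunctor o).obj ⟨n⟩ :=
  mk ((Hom.γ (𝟙 (⟨n⟩ : FTriv)) (𝟙 (⟨n⟩ : FTriv))).comp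
    (Hom.ofEq (Category.comp_id (𝟙 (⟨n⟩ : FTriv)))))

/-- `μ : id_{∗ᵖ} ⊠ id_{∗ᑫ} → id_{∗ᵖ⁺ᑫ}` -/
def mu (p q : ℕ) :
    (idFunctor o).obj ⟨p⟩ ⊗ (idFunctor o).obj ⟨q⟩ ⟶ (idFunctor o).obj ⟨p + q⟩ :=
  mk ((Hom.μ (𝟙 (⟨p⟩ : FTriv)) (𝟙 (⟨q⟩ : FTriv))).comp
    (Hom.ofEq (id_tensorHom_id (⟨p⟩ : FTriv) ⟨q⟩)))

/-- `∅ → id_{∗ⁿ}`, if units for `γ` are adjoined -/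
def gammaUnit (h : o.γUnits = true) (n : ℕ) :
    𝟙_ (NCPlus o FTriv) ⟶ (idFunctor o).obj ⟨n⟩ :=
  mk (Hom.γUnit h (⟨n⟩ : FTriv))

/-- `∅ → id_{∗⁰}`, if a unit for `μ` is adjoined -/
def muUnit (h : o.μUnit = true) : 𝟙_ (NCPlus o FTriv) ⟶ (idFunctor o).obj ⟨0⟩ :=
  mk (Hom.μUnit h)

end NCPlus

variable {o C}

open Functor.LaxMonoidal in
/-- The symmetric sequence `M(n) = O(id_{∗ⁿ})` with its structure maps: the multiplication of `M(n)`
is the image of `γ : id_{∗ⁿ} ⊠ id_{∗ⁿ} → id_{∗ⁿ}`, and the multiplication of `M` is assembled from the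
images of `μ : id_{∗ᵖ} ⊠ id_{∗ᑫ} → id_{∗ᵖ⁺ᑫ}`. -/
def symmSeqOfFunctorObj (O : StrongSymmFunctor (NCPlus o FTriv) C) : SymmSeqData o C where
  M := NCPlus.idFunctor o ⋙ O.functor
  γ n := Functor.LaxMonoidal.μ O.functor _ _ ≫ O.functor.map (NCPlus.gamma o n)
  γUnit h n := ε O.functor ≫ O.functor.map (NCPlus.gammaUnit o h n)
  mul := SymmSeq.gradedMul _ fun p q =>
    Functor.LaxMonoidal.μ O.functor _ _ ≫ O.functor.map (NCPlus.mu o p q)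
  one h := SymmSeq.gradedOne _ (ε O.functor ≫ O.functor.map (NCPlus.muUnit o h))

open Functor.LaxMonoidal in
/-- The functor that sends `O` to the symmetric sequence `M(n) = O(id_{∗ⁿ})` with its structure
maps. -/
def symmSeqOfFunctor (o : NCPlusOptions) (C : Type u) [Category.{v} C] [MonoidalCategory C]
    [SymmetricCategory C] [HasFiniteCoproducts C]
    [∀ X : C, PreservesFiniteCoproducts (tensorLeft X)] :
    StrongSymmFunctor (NCPlus o FTriv) C ⥤ SymmSeqData o C where
  obj := symmSeqOfFunctorObj
  map {O P} f :=
    { f := Functor.whiskerLeft (NCPlus.idFunctor o) f.natTrans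
      γ_comp := fun n => by
        change (Functor.LaxMonoidal.μ O.functor _ _ ≫ O.functor.map (NCPlus.gamma o n)) ≫
          f.natTrans.app _ = (f.natTrans.app _ ⊗ₘ f.natTrans.app _) ≫
            Functor.LaxMonoidal.μ P.functor _ _ ≫ P.functor.map (NCPlus.gamma o n)
        rw [Category.assoc, f.natTrans.naturality, NatTrans.IsMonoidal.tensor_assoc]
      γUnit_comp := fun h n => by
        change (ε O.functor ≫ O.functor.map (NCPlus.gammaUnit o h n)) ≫ f.natTrans.app _ =
          ε P.functor ≫ P.functor.map (NCPlus.gammaUnit o h n)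
        rw [Category.assoc, f.natTrans.naturality, NatTrans.IsMonoidal.unit_assoc]
      mul_comp := by
        refine SymmSeq.gradedMul_comp (Functor.whiskerLeft (NCPlus.idFunctor o) f.natTrans)
          (fun p q => Functor.LaxMonoidal.μ O.functor _ _ ≫ O.functor.map (NCPlus.mu o p q))
          (fun p q => Functor.LaxMonoidal.μ P.functor _ _ ≫ P.functor.map (NCPlus.mu o p q))
          fun p q => ?_
        change (Functor.LaxMonoidal.μ O.functor _ _ ≫ O.functor.map (NCPlus.mu o p q)) ≫
          f.natTrans.app _ = (f.natTrans.app _ ⊗ₘ f.natTrans.app _) ≫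
            Functor.LaxMonoidal.μ P.functor _ _ ≫ P.functor.map (NCPlus.mu o p q)
        rw [Category.assoc, f.natTrans.naturality, NatTrans.IsMonoidal.tensor_assoc]
      one_comp := fun h => by
        refine SymmSeq.gradedOne_comp (Functor.whiskerLeft (NCPlus.idFunctor o) f.natTrans) _ _ ?_
        change (ε O.functor ≫ O.functor.map (NCPlus.muUnit o h)) ≫ f.natTrans.app _ =
          ε P.functor ≫ P.functor.map (NCPlus.muUnit o h)
        rw [Category.assoc, f.natTrans.naturality, NatTrans.IsMonoidal.unit_assoc] }
  map_id O := rfl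
  map_comp f g := rfl

end Target

end

/-! Every morphism `φ : X ⟶ Y` of `FTriv` is invertible, so in the nc-plus construction the object
`of φ` is isomorphic to `of (𝟙 X)` through `(id ⇓ φ⁻¹)`, and an isomorphism `(σ ⇓ σ') : φ → ψ` is
determined by `σ`, since `σ' = φ⁻¹ ≫ σ ≫ ψ`. Up to these canonical isomorphisms the objects are
words in the identities, and all generators reduce to the permutation action, `γ` and `μ` on
identities, and the optional units (`isoHom_eq`, `gammaHom_eq`, `muHom_eq`).

The identities form a monoid object inside the nc-plus construction itself
(`isMonoid_universalComponents`). A lax braided functor carries monoid objects to monoid objects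
(`IsMonoid.mapLax`), hence `M_O` is one.

Full faithfulness: a monoidal transformation is determined on words by its values on identities
(`natTrans_ext`). Conversely a morphism of monoid objects extends along the isomorphisms above and
along `⊠`, and naturality of the extension needs checking only on the generators
(`extendApp_natural_mk`).

Essential surjectivity: from a monoid object `S` a strictly monoidal functor is built that sends `φ
: X ⟶ Y` to `M(X)`. In `φ₁ ⊠ φ₀ → φ₁ ∘ φ₀` the value of `φ₁` lies in `M(Y)`, so it is moved back to
`M(X)` by `φ₀⁻¹` before multiplying (`twistedγ`). The relations then hold by the monoid axioms
(`IsMonoid.evalHom_eq`), and restriction to identities returns `S` on the nose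
(`mapLax_evalFunctor`).

All this is done with the components `M(p) ⊗ M(q) ⟶ M(p + q)`. The passage to the product of graded
objects rests on maps out of a coproduct being determined by their restrictions to the summands
(`isMonoid_iff_components`). -/

noncomputable section

/-! ### Monoid objects in terms of components -/

/-- The structure maps of a monoid object in symmetric sequences of monoids, given by their
components. In contrast to `SymmSeqData`, this makes sense in every monoidal category. -/
structure SymmSeqComponents (o : NCPlusOptions) (A : Type u) [Category.{v} A]
    [MonoidalCategory A] where
  /-- the symmetric sequence -/
  M : FTriv ⥤ A
  /-- the multiplication of each `M(X)` -/
  γ (X : FTriv) : M.obj X ⊗ M.obj X ⟶ M.obj X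
  /-- the unit of each `M(X)` -/
  γUnit (h : o.γUnits = true) (X : FTriv) : 𝟙_ A ⟶ M.obj X
  /-- the components of the multiplication of `M` -/
  μ (X Y : FTriv) : M.obj X ⊗ M.obj Y ⟶ M.obj (X ⊗ Y)
  /-- the component of the unit of `M` -/
  μUnit (h : o.μUnit = true) : 𝟙_ A ⟶ M.obj (𝟙_ FTriv)

namespace SymmSeqComponents

variable {o : NCPlusOptions} {A : Type u} [Category.{v} A] [MonoidalCategory A]
  [SymmetricCategory A]

/-- The axioms of a monoid object in symmetric sequences of monoids, in terms of components. -/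
structure IsMonoid (S : SymmSeqComponents o A) : Prop where
  γ_assoc (X : FTriv) : S.γ X ▷ S.M.obj X ≫ S.γ X =
    (α_ _ _ _).hom ≫ S.M.obj X ◁ S.γ X ≫ S.γ X
  γUnit_left (h : o.γUnits = true) (X : FTriv) :
    S.γUnit h X ▷ S.M.obj X ≫ S.γ X = (λ_ _).hom
  γUnit_right (h : o.γUnits = true) (X : FTriv) :
    S.M.obj X ◁ S.γUnit h X ≫ S.γ X = (ρ_ _).hom
  γ_natural {X Y : FTriv} (σ : X ⟶ Y) :
    S.γ X ≫ S.M.map σ = (S.M.map σ ⊗ₘ S.M.map σ) ≫ S.γ Y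
  γUnit_natural (h : o.γUnits = true) {X Y : FTriv} (σ : X ⟶ Y) :
    S.γUnit h X ≫ S.M.map σ = S.γUnit h Y
  μ_assoc (X Y Z : FTriv) : S.μ X Y ▷ S.M.obj Z ≫ S.μ (X ⊗ Y) Z ≫ S.M.map (α_ X Y Z).hom =
    (α_ _ _ _).hom ≫ S.M.obj X ◁ S.μ Y Z ≫ S.μ X (Y ⊗ Z)
  μUnit_left (h : o.μUnit = true) (X : FTriv) :
    S.μUnit h ▷ S.M.obj X ≫ S.μ (𝟙_ FTriv) X ≫ S.M.map (λ_ X).hom = (λ_ _).hom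
  μUnit_right (h : o.μUnit = true) (X : FTriv) :
    S.M.obj X ◁ S.μUnit h ≫ S.μ X (𝟙_ FTriv) ≫ S.M.map (ρ_ X).hom = (ρ_ _).hom
  μ_natural {X X' Y Y' : FTriv} (σ : X ⟶ X') (τ : Y ⟶ Y') :
    S.μ X Y ≫ S.M.map (σ ⊗ₘ τ) = (S.M.map σ ⊗ₘ S.M.map τ) ≫ S.μ X' Y'
  interchange (X Y : FTriv) : (S.μ X Y ⊗ₘ S.μ X Y) ≫ S.γ (X ⊗ Y) =
    tensorμ (S.M.obj X) (S.M.obj Y) (S.M.obj X) (S.M.obj Y) ≫ (S.γ X ⊗ₘ S.γ Y) ≫ S.μ X Y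
  μ_γUnit (h : o.γUnits = true) (X Y : FTriv) :
    (S.γUnit h X ⊗ₘ S.γUnit h Y) ≫ S.μ X Y = (λ_ _).hom ≫ S.γUnit h (X ⊗ Y)
  γ_μUnit (h : o.μUnit = true) :
    (S.μUnit h ⊗ₘ S.μUnit h) ≫ S.γ (𝟙_ FTriv) = (λ_ _).hom ≫ S.μUnit h
  μUnit_eq_γUnit (h : o.γUnits = true) (h' : o.μUnit = true) :
    S.μUnit h' = S.γUnit h (𝟙_ FTriv)
  commutative (h : o.symmetric = true) (X Y : FTriv) :
    S.μ X Y ≫ S.M.map (β_ X Y).hom = (β_ _ _).hom ≫ S.μ Y X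

end SymmSeqComponents

/-- There are only morphisms between strings of the same length. -/
lemma FTriv.len_eq_of_hom {X Y : FTriv} (σ : X ⟶ Y) : X.len = Y.len := by
  have e : Fin X.len ≃ Fin Y.len := σ
  simpa using Fintype.card_congr e

/-- The morphism of `FTriv` that identifies two strings of the same length. -/
def FTriv.homOfEq {m n : ℕ} (h : m = n) : (⟨m⟩ : FTriv) ⟶ ⟨n⟩ := finCongr h

lemma FTriv.homOfEq_rfl (n : ℕ) : FTriv.homOfEq (rfl : n = n) = 𝟙 (⟨n⟩ : FTriv) := rfl

lemma FTriv.homOfEq_trans {m n k : ℕ} (h : m = n) (h' : n = k) :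
    FTriv.homOfEq h ≫ FTriv.homOfEq h' = FTriv.homOfEq (h.trans h') := rfl

/-! ### Graded axioms versus axioms for components -/

namespace SymmSeqData

open GradedObject

variable {o : NCPlusOptions} {C : Type u} [Category.{v} C] [MonoidalCategory C]
  [SymmetricCategory C] [HasFiniteCoproducts C]
  [∀ X : C, PreservesFiniteCoproducts (tensorLeft X)]

/-- The components of the structure maps. -/
def components (D : SymmSeqData o C) : SymmSeqComponents o C where
  M := D.M
  γ X := D.γ X.len
  γUnit h X := D.γUnit h X.len
  μ X Y := D.μ X.len Y.len
  μUnit h := D.η h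

/-- Transport along an equality of degrees is written as the action of a morphism of `FTriv`. The
index changes in the graded axioms thereby become the associators and unitors of `FTriv`. -/
lemma ι_mul (D : SymmSeqData o C) (p q n : ℕ) (h : p + q = n) :
    Monoidal.ιTensorObj D.M.graded D.M.graded p q n h ≫ D.mul n =
      D.μ p q ≫ D.M.map (FTriv.homOfEq h) := by
  subst h
  rw [FTriv.homOfEq_rfl]
  exact ((congrArg (D.μ p q ≫ ·) (D.M.map_id _)).trans (Category.comp_id _)).symm

lemma ι_mul_whiskerRight_mul (D : SymmSeqData o C) (p q r n : ℕ) (h : p + q + r = n) :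
    Monoidal.ιTensorObj₃' D.M.graded D.M.graded D.M.graded p q r n h ≫
        (D.mul ▷ D.M.graded ≫ D.mul) n =
      D.μ p q ▷ D.M.obj ⟨r⟩ ≫ D.μ (p + q) r ≫ D.M.map (FTriv.homOfEq h) := by
  have h₁ : Monoidal.ιTensorObj (D.M.graded ⊗ D.M.graded) D.M.graded (p + q) r n h ≫
      (D.mul ▷ D.M.graded) n = (D.mul (p + q) ⊗ₘ 𝟙 (D.M.graded r)) ≫
        Monoidal.ιTensorObj D.M.graded D.M.graded (p + q) r n h :=
    Monoidal.ι_tensorHom D.mul (𝟙 D.M.graded) (p + q) r n h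
  rw [Monoidal.ιTensorObj₃'_eq _ _ _ p q r n h (p + q) rfl]
  change (_ ≫ Monoidal.ιTensorObj (D.M.graded ⊗ D.M.graded) D.M.graded (p + q) r n h) ≫
    (D.mul ▷ D.M.graded) n ≫ D.mul n = _
  rw [Category.assoc, reassoc_of% h₁, tensorHom_id, ← comp_whiskerRight_assoc]
  exact congrArg (D.μ p q ▷ D.M.obj ⟨r⟩ ≫ ·) (D.ι_mul (p + q) r n h)

lemma ι_mul_whiskerLeft_mul (D : SymmSeqData o C) (p q r n : ℕ) (h : p + q + r = n) :
    Monoidal.ιTensorObj₃ D.M.graded D.M.graded D.M.graded p q r n h ≫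
        (D.M.graded ◁ D.mul ≫ D.mul) n =
      D.M.obj ⟨p⟩ ◁ D.μ q r ≫ D.μ p (q + r) ≫
        D.M.map (FTriv.homOfEq ((Nat.add_assoc p q r).symm.trans h)) := by
  have h₁ : Monoidal.ιTensorObj D.M.graded (D.M.graded ⊗ D.M.graded) p (q + r) n
        ((Nat.add_assoc p q r).symm.trans h) ≫
      (D.M.graded ◁ D.mul) n = (𝟙 (D.M.graded p) ⊗ₘ D.mul (q + r)) ≫
        Monoidal.ιTensorObj D.M.graded D.M.graded p (q + r) n
          ((Nat.add_assoc p q r).symm.trans h) :=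
    Monoidal.ι_tensorHom (𝟙 D.M.graded) D.mul p (q + r) n ((Nat.add_assoc p q r).symm.trans h)
  rw [Monoidal.ιTensorObj₃_eq _ _ _ p q r n h (q + r) rfl]
  change (_ ≫ Monoidal.ιTensorObj D.M.graded (D.M.graded ⊗ D.M.graded) p (q + r) n _) ≫
    (D.M.graded ◁ D.mul) n ≫ D.mul n = _
  rw [Category.assoc, reassoc_of% h₁, id_tensorHom, ← whiskerLeft_comp_assoc]
  exact congrArg (D.M.obj ⟨p⟩ ◁ D.μ q r ≫ ·) (D.ι_mul p (q + r) n _)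

/-- Morphisms out of a triple graded product are determined on the summands with `p + q + r = n`,
and on each of them the graded associator is the associator of `C`. -/
lemma mul_assoc_iff (D : SymmSeqData o C) :
    D.mul ▷ D.M.graded ≫ D.mul = (α_ _ _ _).hom ≫ D.M.graded ◁ D.mul ≫ D.mul ↔
      ∀ p q r : ℕ, D.μ p q ▷ D.M.obj ⟨r⟩ ≫ D.μ (p + q) r ≫
          D.M.map (FTriv.homOfEq (Nat.add_assoc p q r)) =
        (α_ _ _ _).hom ≫ D.M.obj ⟨p⟩ ◁ D.μ q r ≫ D.μ p (q + r) := by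
  have key (p q r n : ℕ) (h : p + q + r = n) :
      Monoidal.ιTensorObj₃' D.M.graded D.M.graded D.M.graded p q r n h ≫
        ((α_ D.M.graded D.M.graded D.M.graded).hom ≫ D.M.graded ◁ D.mul ≫ D.mul) n =
      (α_ _ _ _).hom ≫ D.M.obj ⟨p⟩ ◁ D.μ q r ≫ D.μ p (q + r) ≫
        D.M.map (FTriv.homOfEq ((Nat.add_assoc p q r).symm.trans h)) := by
    have h₁ : Monoidal.ιTensorObj₃' D.M.graded D.M.graded D.M.graded p q r n h ≫
        (α_ D.M.graded D.M.graded D.M.graded).hom n = (α_ _ _ _).hom ≫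
          Monoidal.ιTensorObj₃ D.M.graded D.M.graded D.M.graded p q r n h :=
      Monoidal.ιTensorObj₃'_associator_hom _ _ _ p q r n h
    rw [← ι_mul_whiskerLeft_mul]
    change _ ≫ (α_ D.M.graded D.M.graded D.M.graded).hom n ≫
      (D.M.graded ◁ D.mul ≫ D.mul) n = _
    rw [reassoc_of% h₁]
    rfl
  constructor
  · intro H p q r
    -- In degree `n = p + (q + r)` the transport on the right is an identity, and the one on the
    -- left is the associator of `FTriv`.
    have := D.ι_mul_whiskerRight_mul p q r _ (Nat.add_assoc p q r)
    rw [H, key, FTriv.homOfEq_rfl] at this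
    rw [← this]
    refine congrArg (fun f => _ ≫ _ ≫ f) ?_
    exact ((congrArg (D.μ p (q + r) ≫ ·) (D.M.map_id _)).trans (Category.comp_id _))
  · intro H
    funext n
    refine Monoidal.tensorObj₃'_ext _ _ fun p q r h => ?_
    refine (D.ι_mul_whiskerRight_mul p q r n h).trans (Eq.trans ?_ (key p q r n h).symm)
    -- A general degree `n` follows by postcomposing with the identification of `p + (q + r)` with
    -- `n`.
    have := H p q r =≫ D.M.map (FTriv.homOfEq ((Nat.add_assoc p q r).symm.trans h))
    simp only [Category.assoc, ← D.M.map_comp, FTriv.homOfEq_trans] at this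
    exact this

/-- In degree `n` the inverse of the graded unitor is the inclusion of the summand `(0, n)`, after
identifying `𝟙_ C` with the degree `0` part of the unit. Precomposing with this isomorphism
therefore tests the axiom on that summand alone. -/
lemma one_left_iff (D : SymmSeqData o C) (h : o.μUnit = true) :
    D.one h ▷ D.M.graded ≫ D.mul = (λ_ _).hom ↔
      ∀ n : ℕ, D.η h ▷ D.M.obj ⟨n⟩ ≫ D.μ 0 n ≫ D.M.map (FTriv.homOfEq (Nat.zero_add n)) =
        (λ_ _).hom := by
  have key (n : ℕ) : (λ_ D.M.graded).inv n ≫ (D.one h ▷ D.M.graded ≫ D.mul) n =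
      (λ_ (D.M.obj ⟨n⟩)).inv ≫ D.η h ▷ D.M.obj ⟨n⟩ ≫ D.μ 0 n ≫
        D.M.map (FTriv.homOfEq (Nat.zero_add n)) := by
    have h₁ : (λ_ D.M.graded).inv n = (λ_ (D.M.graded n)).inv ≫
        Monoidal.tensorUnit₀.inv ▷ D.M.graded n ≫
          Monoidal.ιTensorObj (𝟙_ (GradedObject ℕ C)) D.M.graded 0 n n (Nat.zero_add n) := rfl
    have h₂ : Monoidal.ιTensorObj (𝟙_ (GradedObject ℕ C)) D.M.graded 0 n n (Nat.zero_add n) ≫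
        (D.one h ▷ D.M.graded) n = (D.one h 0 ⊗ₘ 𝟙 (D.M.graded n)) ≫
          Monoidal.ιTensorObj D.M.graded D.M.graded 0 n n (Nat.zero_add n) :=
      Monoidal.ι_tensorHom (D.one h) (𝟙 D.M.graded) 0 n n (Nat.zero_add n)
    change _ ≫ (D.one h ▷ D.M.graded) n ≫ D.mul n = _
    rw [h₁, Category.assoc, Category.assoc, reassoc_of% h₂, tensorHom_id,
      ← comp_whiskerRight_assoc]
    exact congrArg ((λ_ (D.M.obj ⟨n⟩)).inv ≫ D.η h ▷ D.M.obj ⟨n⟩ ≫ ·)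
      (D.ι_mul 0 n n (Nat.zero_add n))
  rw [← cancel_epi (λ_ D.M.graded).inv, Iso.inv_hom_id]
  constructor
  · intro H n
    rw [← cancel_epi (λ_ (D.M.obj ⟨n⟩)).inv, ← key, Iso.inv_hom_id]
    exact congrFun H n
  · intro H
    funext n
    refine (key n).trans ?_
    rw [H, Iso.inv_hom_id]
    rfl

lemma one_right_iff (D : SymmSeqData o C) (h : o.μUnit = true) :
    D.M.graded ◁ D.one h ≫ D.mul = (ρ_ _).hom ↔
      ∀ n : ℕ, D.M.obj ⟨n⟩ ◁ D.η h ≫ D.μ n 0 ≫ D.M.map (FTriv.homOfEq (Nat.add_zero n)) =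
        (ρ_ _).hom := by
  have key (n : ℕ) : (ρ_ D.M.graded).inv n ≫ (D.M.graded ◁ D.one h ≫ D.mul) n =
      (ρ_ (D.M.obj ⟨n⟩)).inv ≫ D.M.obj ⟨n⟩ ◁ D.η h ≫ D.μ n 0 ≫
        D.M.map (FTriv.homOfEq (Nat.add_zero n)) := by
    have h₁ : (ρ_ D.M.graded).inv n = (ρ_ (D.M.graded n)).inv ≫
        D.M.graded n ◁ Monoidal.tensorUnit₀.inv ≫
          Monoidal.ιTensorObj D.M.graded (𝟙_ (GradedObject ℕ C)) n 0 n (Nat.add_zero n) := rfl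
    have h₂ : Monoidal.ιTensorObj D.M.graded (𝟙_ (GradedObject ℕ C)) n 0 n (Nat.add_zero n) ≫
        (D.M.graded ◁ D.one h) n = (𝟙 (D.M.graded n) ⊗ₘ D.one h 0) ≫
          Monoidal.ιTensorObj D.M.graded D.M.graded n 0 n (Nat.add_zero n) :=
      Monoidal.ι_tensorHom (𝟙 D.M.graded) (D.one h) n 0 n (Nat.add_zero n)
    change _ ≫ (D.M.graded ◁ D.one h) n ≫ D.mul n = _
    rw [h₁, Category.assoc, Category.assoc, reassoc_of% h₂, id_tensorHom,
      ← whiskerLeft_comp_assoc]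
    exact congrArg ((ρ_ (D.M.obj ⟨n⟩)).inv ≫ D.M.obj ⟨n⟩ ◁ D.η h ≫ ·)
      (D.ι_mul n 0 n (Nat.add_zero n))
  rw [← cancel_epi (ρ_ D.M.graded).inv, Iso.inv_hom_id]
  constructor
  · intro H n
    rw [← cancel_epi (ρ_ (D.M.obj ⟨n⟩)).inv, ← key, Iso.inv_hom_id]
    exact congrFun H n
  · intro H
    funext n
    refine (key n).trans ?_
    rw [H, Iso.inv_hom_id]
    rfl

lemma isMonoid_iff_components (D : SymmSeqData o C) : D.IsMonoid ↔ D.components.IsMonoid where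
  mp H :=
    { γ_assoc := fun X => H.γ_assoc X.len
      γUnit_left := fun h X => H.γUnit_left h X.len
      γUnit_right := fun h X => H.γUnit_right h X.len
      γ_natural := by
        rintro ⟨m⟩ ⟨n⟩ σ
        -- A morphism of `FTriv` preserves length, so naturality is no more than equivariance for
        -- the permutations of one string.
        obtain rfl : m = n := FTriv.len_eq_of_hom σ
        exact H.γ_equivariant m σ
      γUnit_natural := by
        rintro h ⟨m⟩ ⟨n⟩ σ
        obtain rfl : m = n := FTriv.len_eq_of_hom σ
        exact H.γUnit_equivariant h m σ
      μ_assoc := fun X Y Z => D.mul_assoc_iff.mp H.mul_assoc X.len Y.len Z.len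
      μUnit_left := fun h X => (D.one_left_iff h).mp (H.one_left h) X.len
      μUnit_right := fun h X => (D.one_right_iff h).mp (H.one_right h) X.len
      μ_natural := by
        rintro ⟨p⟩ ⟨p'⟩ ⟨q⟩ ⟨q'⟩ σ τ
        obtain rfl : p = p' := FTriv.len_eq_of_hom σ
        obtain rfl : q = q' := FTriv.len_eq_of_hom τ
        exact H.μ_equivariant p q σ τ
      interchange := fun X Y => H.interchange X.len Y.len
      μ_γUnit := fun h X Y => H.μ_γUnit h X.len Y.len
      γ_μUnit := fun h => H.γ_η h
      μUnit_eq_γUnit := fun h h' => H.η_eq_γUnit h h'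
      commutative := fun h X Y => H.commutative h X.len Y.len }
  mpr H :=
    { γ_assoc := fun n => H.γ_assoc ⟨n⟩
      γUnit_left := fun h n => H.γUnit_left h ⟨n⟩
      γUnit_right := fun h n => H.γUnit_right h ⟨n⟩
      γ_equivariant := fun n σ => H.γ_natural σ
      γUnit_equivariant := fun h n σ => H.γUnit_natural h σ
      mul_assoc := D.mul_assoc_iff.mpr fun p q r => H.μ_assoc ⟨p⟩ ⟨q⟩ ⟨r⟩
      one_left := fun h => (D.one_left_iff h).mpr fun n => H.μUnit_left h ⟨n⟩
      one_right := fun h => (D.one_right_iff h).mpr fun n => H.μUnit_right h ⟨n⟩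
      μ_equivariant := fun p q σ τ => H.μ_natural σ τ
      interchange := fun p q => H.interchange ⟨p⟩ ⟨q⟩
      μ_γUnit := fun h p q => H.μ_γUnit h ⟨p⟩ ⟨q⟩
      γ_η := fun h => H.γ_μUnit h
      η_eq_γUnit := fun h h' => H.μUnit_eq_γUnit h h'
      commutative := fun h p q => H.commutative h ⟨p⟩ ⟨q⟩ }

end SymmSeqData

/-! ### The universal monoid object inside the nc-plus construction -/

namespace NCPlus

section Generators

variable {o : NCPlusOptions} {M : Type u₁} [Category.{v₁} M] [MonoidalCategory M]
  [SymmetricCategory M]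

/-- The class of the isomorphism `(σ ⇓ σ')`. -/
def isoHom {X Y X' Y' : M} (φ : X ⟶ Y) (ψ : X' ⟶ Y') (σ : X ≅ X') (σ' : Y ≅ Y')
    (h : φ ≫ σ'.hom = σ.hom ≫ ψ) : (of φ : NCPlus o M) ⟶ of ψ :=
  mk (.iso φ ψ σ σ' h)

/-- The class of `(id ⇓ id)` between two equal morphisms. -/
def eqHom {X Y : M} {φ ψ : X ⟶ Y} (h : φ = ψ) : (of φ : NCPlus o M) ⟶ of ψ :=
  mk (.ofEq h)

/-- The class of a `γ`-morphism. -/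
def gammaHom {X Y Z : M} (φ₁ : Y ⟶ Z) (φ₀ : X ⟶ Y) :
    (of φ₁ ⊗ of φ₀ : NCPlus o M) ⟶ of (φ₀ ≫ φ₁) :=
  mk (.γ φ₁ φ₀)

/-- The class of a `μ`-morphism. -/
def muHom {X₁ Y₁ X₂ Y₂ : M} (φ₁ : X₁ ⟶ Y₁) (φ₂ : X₂ ⟶ Y₂) :
    (of φ₁ ⊗ of φ₂ : NCPlus o M) ⟶ of (φ₁ ⊗ₘ φ₂) :=
  mk (.μ φ₁ φ₂)

/-- The class of a unit for the `γ`-morphisms. -/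
def gammaUnitHom (hu : o.γUnits = true) (X : M) : 𝟙_ (NCPlus o M) ⟶ of (𝟙 X) :=
  mk (.γUnit hu X)

/-- The class of the unit for the `μ`-morphisms. -/
def muUnitHom (hu : o.μUnit = true) : 𝟙_ (NCPlus o M) ⟶ of (𝟙 (𝟙_ M)) :=
  mk (.μUnit hu)

lemma eqHom_rfl {X Y : M} (φ : X ⟶ Y) : (eqHom rfl : (of φ : NCPlus o M) ⟶ of φ) = 𝟙 _ :=
  Quotient.sound (.iso_refl φ)

lemma eqHom_trans {X Y : M} {φ ψ χ : X ⟶ Y} (h : φ = ψ) (h' : ψ = χ) :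
    (eqHom h : (of φ : NCPlus o M) ⟶ _) ≫ eqHom h' = eqHom (h.trans h') := by
  subst h h'
  simp [eqHom_rfl]

/-- Together with `eqHom_trans` and `isoHom_eqHom` this absorbs the comparison isomorphisms between
equal morphisms, such as `𝟙 X ≫ 𝟙 X` and `𝟙 X`, that the relations carry along. -/
lemma eqHom_isoHom {X Y X' Y' : M} {φ φ' : X ⟶ Y} (e : φ = φ') (ψ : X' ⟶ Y') (σ : X ≅ X')
    (σ' : Y ≅ Y') (h : φ' ≫ σ'.hom = σ.hom ≫ ψ) :
    (eqHom e : (of φ : NCPlus o M) ⟶ _) ≫ isoHom φ' ψ σ σ' h = isoHom φ ψ σ σ' (e ▸ h) := by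
  subst e
  simp [eqHom_rfl]

lemma isoHom_eqHom {X Y X' Y' : M} (φ : X ⟶ Y) {ψ ψ' : X' ⟶ Y'} (σ : X ≅ X')
    (σ' : Y ≅ Y') (h : φ ≫ σ'.hom = σ.hom ≫ ψ) (e : ψ = ψ') :
    (isoHom φ ψ σ σ' h : (of φ : NCPlus o M) ⟶ _) ≫ eqHom e = isoHom φ ψ' σ σ' (e ▸ h) := by
  subst e
  simp [eqHom_rfl]

lemma isoHom_comp {X Y X' Y' X'' Y'' : M} (φ : X ⟶ Y) (φ' : X' ⟶ Y') (φ'' : X'' ⟶ Y'')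
    (σ : X ≅ X') (σ' : Y ≅ Y') (τ : X' ≅ X'') (τ' : Y' ≅ Y'')
    (h : φ ≫ σ'.hom = σ.hom ≫ φ') (h' : φ' ≫ τ'.hom = τ.hom ≫ φ'') :
    (isoHom φ φ' σ σ' h : (of φ : NCPlus o M) ⟶ _) ≫ isoHom φ' φ'' τ τ' h' =
      isoHom φ φ'' (σ ≪≫ τ) (σ' ≪≫ τ') (by simp [reassoc_of% h, h']) :=
  Quotient.sound (.iso_trans φ φ' φ'' σ σ' τ τ' h h' _)

lemma gammaHom_natural {X Y Z X' Y' Z' : M} (φ₁ : Y ⟶ Z) (φ₀ : X ⟶ Y) (ψ₁ : Y' ⟶ Z')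
    (ψ₀ : X' ⟶ Y') (σ : X ≅ X') (τ : Y ≅ Y') (σ' : Z ≅ Z')
    (h₁ : φ₁ ≫ σ'.hom = τ.hom ≫ ψ₁) (h₀ : φ₀ ≫ τ.hom = σ.hom ≫ ψ₀) :
    ((isoHom φ₁ ψ₁ τ σ' h₁ : (of φ₁ : NCPlus o M) ⟶ _) ⊗ₘ isoHom φ₀ ψ₀ σ τ h₀) ≫
        gammaHom ψ₁ ψ₀ =
      gammaHom φ₁ φ₀ ≫ isoHom (φ₀ ≫ φ₁) (ψ₀ ≫ ψ₁) σ σ' (by simp [h₁, reassoc_of% h₀]) :=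
  (Quotient.sound (Rel.γ_equivariant φ₁ φ₀ ψ₁ ψ₀ σ τ σ' h₁ h₀ _)).symm

lemma muHom_natural {X₁ Y₁ X₂ Y₂ X₁' Y₁' X₂' Y₂' : M} (φ₁ : X₁ ⟶ Y₁) (φ₂ : X₂ ⟶ Y₂)
    (ψ₁ : X₁' ⟶ Y₁') (ψ₂ : X₂' ⟶ Y₂')
    (σ₁ : X₁ ≅ X₁') (σ₁' : Y₁ ≅ Y₁') (σ₂ : X₂ ≅ X₂') (σ₂' : Y₂ ≅ Y₂')
    (h₁ : φ₁ ≫ σ₁'.hom = σ₁.hom ≫ ψ₁) (h₂ : φ₂ ≫ σ₂'.hom = σ₂.hom ≫ ψ₂) :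
    ((isoHom φ₁ ψ₁ σ₁ σ₁' h₁ : (of φ₁ : NCPlus o M) ⟶ _) ⊗ₘ isoHom φ₂ ψ₂ σ₂ σ₂' h₂) ≫
        muHom ψ₁ ψ₂ =
      muHom φ₁ φ₂ ≫ isoHom (φ₁ ⊗ₘ φ₂) (ψ₁ ⊗ₘ ψ₂) (σ₁ ⊗ᵢ σ₂) (σ₁' ⊗ᵢ σ₂')
        (by simp [h₁, h₂]) :=
  (Quotient.sound (Rel.μ_equivariant φ₁ φ₂ ψ₁ ψ₂ σ₁ σ₁' σ₂ σ₂' h₁ h₂ _)).symm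

lemma eqHom_gammaHom {X Y Z : M} {φ₁ ψ₁ : Y ⟶ Z} {φ₀ ψ₀ : X ⟶ Y} (h₁ : φ₁ = ψ₁)
    (h₀ : φ₀ = ψ₀) :
    ((eqHom h₁ : (of φ₁ : NCPlus o M) ⟶ _) ⊗ₘ eqHom h₀) ≫ gammaHom ψ₁ ψ₀ =
      gammaHom φ₁ φ₀ ≫ eqHom (by rw [h₁, h₀]) := by
  subst h₁ h₀
  simp [eqHom_rfl]

lemma eqHom_muHom {X₁ Y₁ X₂ Y₂ : M} {φ₁ ψ₁ : X₁ ⟶ Y₁} {φ₂ ψ₂ : X₂ ⟶ Y₂} (h₁ : φ₁ = ψ₁)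
    (h₂ : φ₂ = ψ₂) :
    ((eqHom h₁ : (of φ₁ : NCPlus o M) ⟶ _) ⊗ₘ eqHom h₂) ≫ muHom ψ₁ ψ₂ =
      muHom φ₁ φ₂ ≫ eqHom (by rw [h₁, h₂]) := by
  subst h₁ h₂
  simp [eqHom_rfl]

lemma gammaHom_assoc {W X Y Z : M} (φ₂ : Y ⟶ Z) (φ₁ : X ⟶ Y) (φ₀ : W ⟶ X) :
    (gammaHom φ₂ φ₁ ▷ of φ₀ : ((of φ₂ ⊗ of φ₁) ⊗ of φ₀ : NCPlus o M) ⟶ _) ≫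
        gammaHom (φ₁ ≫ φ₂) φ₀ =
      (α_ _ _ _).hom ≫ of φ₂ ◁ gammaHom φ₁ φ₀ ≫ gammaHom φ₂ (φ₀ ≫ φ₁) ≫
        eqHom (Category.assoc φ₀ φ₁ φ₂) :=
  Quotient.sound (.γ_assoc φ₂ φ₁ φ₀)

lemma muHom_assoc {X₁ Y₁ X₂ Y₂ X₃ Y₃ : M} (φ₁ : X₁ ⟶ Y₁) (φ₂ : X₂ ⟶ Y₂) (φ₃ : X₃ ⟶ Y₃) :
    (muHom φ₁ φ₂ ▷ of φ₃ : ((of φ₁ ⊗ of φ₂) ⊗ of φ₃ : NCPlus o M) ⟶ _) ≫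
        muHom (φ₁ ⊗ₘ φ₂) φ₃ ≫ isoHom ((φ₁ ⊗ₘ φ₂) ⊗ₘ φ₃) (φ₁ ⊗ₘ (φ₂ ⊗ₘ φ₃))
          (α_ X₁ X₂ X₃) (α_ Y₁ Y₂ Y₃) (associator_naturality φ₁ φ₂ φ₃) =
      (α_ _ _ _).hom ≫ of φ₁ ◁ muHom φ₂ φ₃ ≫ muHom φ₁ (φ₂ ⊗ₘ φ₃) :=
  Quotient.sound (.μ_assoc φ₁ φ₂ φ₃)

lemma muHom_gammaHom {X Y Z X' Y' Z' : M} (φ₁ : Y ⟶ Z) (φ₀ : X ⟶ Y) (ψ₁ : Y' ⟶ Z')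
    (ψ₀ : X' ⟶ Y') :
    (muHom φ₁ ψ₁ ⊗ₘ muHom φ₀ ψ₀ :
          ((of φ₁ ⊗ of ψ₁) ⊗ (of φ₀ ⊗ of ψ₀) : NCPlus o M) ⟶ _) ≫
        gammaHom (φ₁ ⊗ₘ ψ₁) (φ₀ ⊗ₘ ψ₀) ≫ eqHom (tensorHom_comp_tensorHom φ₀ ψ₀ φ₁ ψ₁) =
      tensorμ (of φ₁) (of ψ₁) (of φ₀) (of ψ₀) ≫ (gammaHom φ₁ φ₀ ⊗ₘ gammaHom ψ₁ ψ₀) ≫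
        muHom (φ₀ ≫ φ₁) (ψ₀ ≫ ψ₁) :=
  Quotient.sound (.interchange φ₁ φ₀ ψ₁ ψ₀)

lemma muHom_braiding (hs : o.symmetric = true) {X₁ Y₁ X₂ Y₂ : M} (φ₁ : X₁ ⟶ Y₁)
    (φ₂ : X₂ ⟶ Y₂) :
    (muHom φ₁ φ₂ : (of φ₁ ⊗ of φ₂ : NCPlus o M) ⟶ _) ≫
        isoHom (φ₁ ⊗ₘ φ₂) (φ₂ ⊗ₘ φ₁) (β_ X₁ X₂) (β_ Y₁ Y₂)
          (BraidedCategory.braiding_naturality φ₁ φ₂) =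
      (β_ _ _).hom ≫ muHom φ₂ φ₁ :=
  Quotient.sound (.μ_symmetric hs φ₁ φ₂)

/-- The multiplication of `id_X`. -/
def idGamma (X : M) : (of (𝟙 X) ⊗ of (𝟙 X) : NCPlus o M) ⟶ of (𝟙 X) :=
  gammaHom (𝟙 X) (𝟙 X) ≫ eqHom (Category.comp_id (𝟙 X))

/-- The `⊠`-product of identities maps to the identity of the product. -/
def idMu (X Y : M) : (of (𝟙 X) ⊗ of (𝟙 Y) : NCPlus o M) ⟶ of (𝟙 (X ⊗ Y)) :=
  muHom (𝟙 X) (𝟙 Y) ≫ eqHom (id_tensorHom_id X Y)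

/-- The action of an isomorphism on identities. -/
def idMap {X Y : M} (σ : X ≅ Y) : (of (𝟙 X) : NCPlus o M) ⟶ of (𝟙 Y) :=
  isoHom (𝟙 X) (𝟙 Y) σ σ ((Category.id_comp _).trans (Category.comp_id _).symm)

/-- Sliding the comparisons `eqHom` past `gammaHom` collects them at the end. What remains is
associativity of `γ` for three identities, and the collected comparisons agree because they depend
only on their endpoints. -/
lemma idGamma_assoc (X : M) :
    (idGamma X ▷ of (𝟙 X) : ((of (𝟙 X) ⊗ of (𝟙 X)) ⊗ of (𝟙 X) : NCPlus o M) ⟶ _) ≫ idGamma X =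
      (α_ _ _ _).hom ≫ of (𝟙 X) ◁ idGamma X ≫ idGamma X := by
  have h₁ := eqHom_gammaHom (o := o) (Category.comp_id (𝟙 X)) (Eq.refl (𝟙 X))
  have h₂ := eqHom_gammaHom (o := o) (Eq.refl (𝟙 X)) (Category.comp_id (𝟙 X))
  have h₃ := gammaHom_assoc (o := o) (𝟙 X) (𝟙 X) (𝟙 X)
  rw [eqHom_rfl, tensorHom_id (C := NCPlus o M)] at h₁
  rw [eqHom_rfl, id_tensorHom (C := NCPlus o M)] at h₂
  simp only [idGamma, comp_whiskerRight, whiskerLeft_comp, Category.assoc]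
  rw [reassoc_of% h₁, reassoc_of% h₂, reassoc_of% h₃]
  simp only [eqHom_trans]

lemma idGamma_natural {X Y : M} (σ : X ≅ Y) :
    (idGamma X : (_ : NCPlus o M) ⟶ _) ≫ idMap σ = (idMap σ ⊗ₘ idMap σ) ≫ idGamma Y := by
  simp only [idGamma, idMap, Category.assoc, eqHom_isoHom,
    reassoc_of% @gammaHom_natural, isoHom_eqHom]

lemma idMu_natural {X X' Y Y' : M} (σ : X ≅ X') (τ : Y ≅ Y') :
    (idMu X Y : (_ : NCPlus o M) ⟶ _) ≫ idMap (σ ⊗ᵢ τ) =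
      (idMap σ ⊗ₘ idMap τ) ≫ idMu X' Y' := by
  simp only [idMu, idMap, Category.assoc, eqHom_isoHom,
    reassoc_of% @muHom_natural, isoHom_eqHom]

lemma idMu_assoc (X Y Z : M) :
    (idMu X Y ▷ of (𝟙 Z) : ((of (𝟙 X) ⊗ of (𝟙 Y)) ⊗ of (𝟙 Z) : NCPlus o M) ⟶ _) ≫
        idMu (X ⊗ Y) Z ≫ idMap (α_ X Y Z) =
      (α_ _ _ _).hom ≫ of (𝟙 X) ◁ idMu Y Z ≫ idMu X (Y ⊗ Z) := by
  have h₁ := eqHom_muHom (o := o) (id_tensorHom_id X Y) (Eq.refl (𝟙 Z))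
  have h₂ := eqHom_muHom (o := o) (Eq.refl (𝟙 X)) (id_tensorHom_id Y Z)
  have h₃ := muHom_assoc (o := o) (𝟙 X) (𝟙 Y) (𝟙 Z)
  rw [eqHom_rfl, tensorHom_id (C := NCPlus o M)] at h₁
  rw [eqHom_rfl, id_tensorHom (C := NCPlus o M)] at h₂
  simp only [idMu, comp_whiskerRight, whiskerLeft_comp, Category.assoc]
  rw [reassoc_of% h₁, reassoc_of% h₂, ← reassoc_of% h₃]
  simp only [idMap, eqHom_trans, eqHom_isoHom, isoHom_eqHom]

/-- The interchange relation for four identities, once the comparisons are moved past `gammaHom` and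
`muHom` and merged. -/
lemma idMu_idGamma (X Y : M) :
    (idMu X Y ⊗ₘ idMu X Y : ((of (𝟙 X) ⊗ of (𝟙 Y)) ⊗ _ : NCPlus o M) ⟶ _) ≫ idGamma (X ⊗ Y) =
      tensorμ (of (𝟙 X)) (of (𝟙 Y)) (of (𝟙 X)) (of (𝟙 Y)) ≫ (idGamma X ⊗ₘ idGamma Y) ≫
        idMu X Y := by
  have h₁ := muHom_gammaHom (o := o) (𝟙 X) (𝟙 X) (𝟙 Y) (𝟙 Y)
  simp only [idMu, idGamma, ← tensorHom_comp_tensorHom, Category.assoc]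
  rw [reassoc_of% @eqHom_gammaHom, reassoc_of% @eqHom_muHom, ← reassoc_of% h₁]
  simp only [eqHom_trans]

lemma idMu_braiding (hs : o.symmetric = true) (X Y : M) :
    (idMu X Y : (of (𝟙 X) ⊗ of (𝟙 Y) : NCPlus o M) ⟶ _) ≫ idMap (β_ X Y) =
      (β_ _ _).hom ≫ idMu Y X := by
  have h₁ := muHom_braiding hs (𝟙 X) (𝟙 Y)
  simp only [idMu, idMap, Category.assoc, eqHom_isoHom]
  rw [← reassoc_of% h₁, isoHom_eqHom]

lemma gammaUnitHom_natural (hu : o.γUnits = true) {X Y : M} (σ : X ≅ Y) :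
    gammaUnitHom hu X ≫ idMap σ = gammaUnitHom hu Y :=
  Quotient.sound (.γUnit_iso hu σ _)

lemma gammaUnitHom_left (hu : o.γUnits = true) (X : M) :
    gammaUnitHom hu X ▷ of (𝟙 X) ≫ idGamma X = (λ_ _).hom :=
  Quotient.sound (.γUnit_left hu (𝟙 X))

lemma gammaUnitHom_right (hu : o.γUnits = true) (X : M) :
    of (𝟙 X) ◁ gammaUnitHom hu X ≫ idGamma X = (ρ_ _).hom :=
  Quotient.sound (.γUnit_right hu (𝟙 X))

lemma gammaUnitHom_idMu (hu : o.γUnits = true) (X Y : M) :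
    (gammaUnitHom hu X ⊗ₘ gammaUnitHom hu Y) ≫ idMu X Y = (λ_ _).hom ≫ gammaUnitHom hu (X ⊗ Y) :=
  Quotient.sound (.μ_γUnit hu X Y)

lemma muUnitHom_left (hu : o.μUnit = true) (X : M) :
    muUnitHom hu ▷ of (𝟙 X) ≫ idMu (𝟙_ M) X ≫ idMap (λ_ X) = (λ_ _).hom := by
  simp only [idMu, idMap, Category.assoc, eqHom_isoHom]
  exact Quotient.sound (.μUnit_left hu (𝟙 X) _)

lemma muUnitHom_right (hu : o.μUnit = true) (X : M) :
    of (𝟙 X) ◁ muUnitHom hu ≫ idMu X (𝟙_ M) ≫ idMap (ρ_ X) = (ρ_ _).hom := by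
  simp only [idMu, idMap, Category.assoc, eqHom_isoHom]
  exact Quotient.sound (.μUnit_right hu (𝟙 X) _)

lemma muUnitHom_idGamma (hu : o.μUnit = true) :
    (muUnitHom hu ⊗ₘ muUnitHom hu) ≫ idGamma (𝟙_ M) = (λ_ _).hom ≫ muUnitHom hu :=
  Quotient.sound (.γ_μUnit hu)

lemma muUnitHom_eq_gammaUnitHom (hu : o.γUnits = true) (hu' : o.μUnit = true) :
    muUnitHom hu' = gammaUnitHom hu (𝟙_ M) :=
  Quotient.sound (.μUnit_eq_γUnit hu hu')

end Generators

/-- The universal monoid object in symmetric sequences of monoids. -/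
def universalComponents (o : NCPlusOptions) : SymmSeqComponents o (NCPlus o FTriv) where
  M := idFunctor o
  γ X := idGamma X
  γUnit h X := gammaUnitHom h X
  μ X Y := idMu X Y
  μUnit h := muUnitHom h

lemma isMonoid_universalComponents (o : NCPlusOptions) : (universalComponents o).IsMonoid where
  γ_assoc X := idGamma_assoc X
  γUnit_left h X := gammaUnitHom_left h X
  γUnit_right h X := gammaUnitHom_right h X
  γ_natural σ := idGamma_natural (FTriv.toIso σ)
  γUnit_natural h _ _ σ := gammaUnitHom_natural h (FTriv.toIso σ)
  μ_assoc X Y Z := idMu_assoc X Y Z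
  μUnit_left h X := muUnitHom_left h X
  μUnit_right h X := muUnitHom_right h X
  μ_natural σ τ := idMu_natural (FTriv.toIso σ) (FTriv.toIso τ)
  interchange X Y := idMu_idGamma X Y
  μ_γUnit h X Y := gammaUnitHom_idMu h X Y
  γ_μUnit h := muUnitHom_idGamma h
  μUnit_eq_γUnit h h' := muUnitHom_eq_gammaUnitHom h h'
  commutative h X Y := idMu_braiding h X Y

end NCPlus

/-! ### Transport of monoid objects along lax monoidal functors -/

namespace SymmSeqComponents

open Functor.LaxMonoidal

variable {o : NCPlusOptions} {A : Type u₁} [Category.{v₁} A] [MonoidalCategory A]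
  {C : Type u} [Category.{v} C] [MonoidalCategory C]

/-- The image under a lax monoidal functor. -/
def mapLax (S : SymmSeqComponents o A) (F : A ⥤ C) [F.LaxMonoidal] : SymmSeqComponents o C where
  M := S.M ⋙ F
  γ X := Functor.LaxMonoidal.μ F _ _ ≫ F.map (S.γ X)
  γUnit h X := ε F ≫ F.map (S.γUnit h X)
  μ X Y := Functor.LaxMonoidal.μ F _ _ ≫ F.map (S.μ X Y)
  μUnit h := ε F ≫ F.map (S.μUnit h)

/-- Left unitality of `F` at the unit object. It is needed for the axioms in which two units are
multiplied. -/
lemma ε_tensor_ε_μ (F : A ⥤ C) [F.LaxMonoidal] :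
    (ε F ⊗ₘ ε F) ≫ Functor.LaxMonoidal.μ F (𝟙_ A) (𝟙_ A) ≫ F.map (λ_ (𝟙_ A)).hom =
      (λ_ (𝟙_ C)).hom ≫ ε F := by
  rw [← leftUnitor_naturality, left_unitality, tensorHom_def', Category.assoc]

/-- Each axiom is the image under `F` of the same axiom for `S`, with the structure maps of `F`
moved out by naturality and coherence. Compatibility with the braiding enters only through
interchange and commutativity. -/
lemma IsMonoid.mapLax [SymmetricCategory A] [SymmetricCategory C]
    {S : SymmSeqComponents o A} (H : S.IsMonoid) (F : A ⥤ C) [F.LaxBraided] : (S.mapLax F).IsMonoid where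
  γ_assoc X := by
    simp only [SymmSeqComponents.mapLax, Functor.comp_obj]
    have := congrArg F.map (H.γ_assoc X)
    simp only [Functor.map_comp] at this
    simp only [comp_whiskerRight, whiskerLeft_comp, Category.assoc, μ_natural_left_assoc,
      μ_natural_right_assoc, this, associativity_assoc]
  γUnit_left h X := by
    simp only [SymmSeqComponents.mapLax, Functor.comp_obj]
    rw [comp_whiskerRight, Category.assoc, μ_natural_left_assoc, ← F.map_comp, H.γUnit_left,
      ← left_unitality]
  γUnit_right h X := by
    simp only [SymmSeqComponents.mapLax, Functor.comp_obj]
    rw [whiskerLeft_comp, Category.assoc, μ_natural_right_assoc, ← F.map_comp, H.γUnit_right,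
      ← right_unitality]
  γ_natural σ := by
    simp only [SymmSeqComponents.mapLax, Functor.comp_obj, Functor.comp_map]
    rw [Category.assoc, ← F.map_comp, H.γ_natural, F.map_comp, μ_natural_assoc]
  γUnit_natural h _ _ σ := by
    simp only [SymmSeqComponents.mapLax, Functor.comp_obj, Functor.comp_map]
    rw [Category.assoc, ← F.map_comp, H.γUnit_natural]
  μ_assoc X Y Z := by
    simp only [SymmSeqComponents.mapLax, Functor.comp_obj, Functor.comp_map]
    have := congrArg F.map (H.μ_assoc X Y Z)
    simp only [Functor.map_comp] at this
    simp only [comp_whiskerRight, whiskerLeft_comp, Category.assoc, μ_natural_left_assoc,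
      μ_natural_right_assoc, this, associativity_assoc]
  μUnit_left h X := by
    simp only [SymmSeqComponents.mapLax, Functor.comp_obj, Functor.comp_map]
    rw [comp_whiskerRight, Category.assoc, Category.assoc, μ_natural_left_assoc, ← F.map_comp,
      ← F.map_comp, H.μUnit_left, ← left_unitality]
  μUnit_right h X := by
    simp only [SymmSeqComponents.mapLax, Functor.comp_obj, Functor.comp_map]
    rw [whiskerLeft_comp, Category.assoc, Category.assoc, μ_natural_right_assoc, ← F.map_comp,
      ← F.map_comp, H.μUnit_right, ← right_unitality]
  μ_natural σ τ := by
    simp only [SymmSeqComponents.mapLax, Functor.comp_obj, Functor.comp_map]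
    rw [Category.assoc, ← F.map_comp, H.μ_natural, F.map_comp, μ_natural_assoc]
  interchange X Y := by
    simp only [SymmSeqComponents.mapLax, Functor.comp_obj]
    rw [← tensorHom_comp_tensorHom, ← tensorHom_comp_tensorHom, Category.assoc, Category.assoc,
      μ_natural_assoc, μ_natural_assoc, ← F.map_comp, H.interchange, F.map_comp, F.map_comp,
      ← tensorμ_comp_μ_tensorHom_μ_comp_μ_assoc]
  μ_γUnit h X Y := by
    simp only [SymmSeqComponents.mapLax, Functor.comp_obj]
    rw [← tensorHom_comp_tensorHom, Category.assoc, μ_natural_assoc, ← F.map_comp, H.μ_γUnit,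
      F.map_comp, reassoc_of% ε_tensor_ε_μ F]
  γ_μUnit h := by
    simp only [SymmSeqComponents.mapLax, Functor.comp_obj]
    rw [← tensorHom_comp_tensorHom, Category.assoc, μ_natural_assoc, ← F.map_comp, H.γ_μUnit,
      F.map_comp, reassoc_of% ε_tensor_ε_μ F]
  μUnit_eq_γUnit h h' := by
    simp only [SymmSeqComponents.mapLax, H.μUnit_eq_γUnit h h']
  commutative h X Y := by
    simp only [SymmSeqComponents.mapLax, Functor.comp_obj, Functor.comp_map]
    rw [Category.assoc, ← F.map_comp, H.commutative h, F.map_comp,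
      Functor.LaxBraided.braided_assoc]

end SymmSeqComponents

/-! ### Evaluating the nc-plus construction in a monoid object -/

namespace FTriv

lemma toIso_hom {X Y : FTriv} (φ : X ⟶ Y) : (toIso φ).hom = φ := rfl

lemma hom_toIso_inv {X Y : FTriv} (φ : X ⟶ Y) : φ ≫ (toIso φ).inv = 𝟙 X :=
  (toIso φ).hom_inv_id

lemma toIso_inv_hom {X Y : FTriv} (φ : X ⟶ Y) : (toIso φ).inv ≫ φ = 𝟙 Y :=
  (toIso φ).inv_hom_id

lemma toIso_id_inv (X : FTriv) : (toIso (𝟙 X)).inv = 𝟙 X := rfl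

lemma toIso_comp_inv {X Y Z : FTriv} (φ : X ⟶ Y) (ψ : Y ⟶ Z) :
    (toIso (φ ≫ ψ)).inv = (toIso ψ).inv ≫ (toIso φ).inv := rfl

lemma toIso_tensorHom_inv {X Y X' Y' : FTriv} (φ : X ⟶ Y) (ψ : X' ⟶ Y') :
    (toIso (φ ⊗ₘ ψ)).inv = (toIso φ).inv ⊗ₘ (toIso ψ).inv := rfl

lemma toIso_inv_comp_eq {X Y X' Y' : FTriv} {φ : X ⟶ Y} {ψ : X' ⟶ Y'} {σ : X ⟶ X'} {τ : Y ⟶ Y'}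
    (h : φ ≫ τ = σ ≫ ψ) : (toIso φ).inv ≫ σ = τ ≫ (toIso ψ).inv := by
  rw [Iso.inv_comp_eq, toIso_hom, reassoc_of% h, hom_toIso_inv, Category.comp_id]

end FTriv

namespace SymmSeqComponents

variable {o : NCPlusOptions} {C : Type u} [Category.{v} C] [MonoidalCategory C]

/-- The multiplication of `M(X)`, where the first factor is twisted by a permutation. -/
def twistedγ (S : SymmSeqComponents o C) {X Y : FTriv} (φ : X ⟶ Y) :
    S.M.obj Y ⊗ S.M.obj X ⟶ S.M.obj X :=
  (S.M.map (FTriv.toIso φ).inv ⊗ₘ 𝟙 _) ≫ S.γ X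

lemma twistedγ_id (S : SymmSeqComponents o C) (X : FTriv) : S.twistedγ (𝟙 X) = S.γ X := by
  rw [twistedγ, FTriv.toIso_id_inv, S.M.map_id, id_tensorHom_id, Category.id_comp]

namespace IsMonoid

variable [SymmetricCategory C] {S : SymmSeqComponents o C}

/-- The square `h` gives `φ⁻¹ ≫ σ = τ ≫ ψ⁻¹`, so equivariance of the untwisted `γ` is enough. This
becomes the equivariance relation of `γ`. -/
lemma twistedγ_natural (H : S.IsMonoid) {X Y X' Y' : FTriv} (φ : X ⟶ Y) (ψ : X' ⟶ Y')
    (σ : X ⟶ X') (τ : Y ⟶ Y') (h : φ ≫ τ = σ ≫ ψ) :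
    S.twistedγ φ ≫ S.M.map σ = (S.M.map τ ⊗ₘ S.M.map σ) ≫ S.twistedγ ψ := by
  rw [twistedγ, twistedγ, Category.assoc, H.γ_natural, tensorHom_comp_tensorHom_assoc,
    tensorHom_comp_tensorHom_assoc, ← S.M.map_comp, ← S.M.map_comp, FTriv.toIso_inv_comp_eq h,
    Category.id_comp, Category.comp_id]

/-- Both sides move all three factors to `M(W)`, the outermost by `(φ₀ ≫ φ₁)⁻¹` and the middle one
by `φ₀⁻¹`, and multiply there. -/
lemma twistedγ_assoc (H : S.IsMonoid) {W X Y : FTriv} (φ₁ : X ⟶ Y) (φ₀ : W ⟶ X) :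
    (S.twistedγ φ₁ ⊗ₘ 𝟙 _) ≫ S.twistedγ φ₀ =
      (α_ _ _ _).hom ≫ (𝟙 _ ⊗ₘ S.twistedγ φ₀) ≫ S.twistedγ (φ₀ ≫ φ₁) := by
  -- Since permutations act by homomorphisms, moving the inner product to `M(W)` moves each of its
  -- two factors.
  have h₁ : S.twistedγ φ₁ ≫ S.M.map (FTriv.toIso φ₀).inv =
      (S.M.map (FTriv.toIso (φ₀ ≫ φ₁)).inv ⊗ₘ S.M.map (FTriv.toIso φ₀).inv) ≫ S.γ W := by
    rw [H.twistedγ_natural φ₁ (𝟙 W) (FTriv.toIso φ₀).inv (FTriv.toIso (φ₀ ≫ φ₁)).inv,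
      twistedγ_id]
    rw [FTriv.toIso_comp_inv, ← Category.assoc, FTriv.hom_toIso_inv, Category.id_comp,
      Category.comp_id]
  have h₂ := H.γ_assoc W
  rw [← tensorHom_id, ← id_tensorHom] at h₂
  conv_lhs => rw [twistedγ.eq_1 (φ := φ₀), tensorHom_comp_tensorHom_assoc, h₁, Category.comp_id,
    ← Category.comp_id (𝟙 (S.M.obj W)), ← tensorHom_comp_tensorHom, Category.assoc, h₂,
    associator_naturality_assoc, tensorHom_comp_tensorHom_assoc, Category.comp_id]
  rw [twistedγ, twistedγ, tensorHom_comp_tensorHom_assoc, Category.id_comp, Category.comp_id]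

/-- The twist by `(φ ⊗ ψ)⁻¹` splits as `φ⁻¹ ⊗ ψ⁻¹`, so equivariance of `μ` brings it inside and the
untwisted interchange law applies. -/
lemma μ_twistedγ (H : S.IsMonoid) {X Y X' Y' : FTriv} (φ : X ⟶ Y) (ψ : X' ⟶ Y') :
    (S.μ Y Y' ⊗ₘ S.μ X X') ≫ S.twistedγ (φ ⊗ₘ ψ) =
      tensorμ _ _ _ _ ≫ (S.twistedγ φ ⊗ₘ S.twistedγ ψ) ≫ S.μ X X' := by
  rw [twistedγ, FTriv.toIso_tensorHom_inv, tensorHom_comp_tensorHom_assoc, H.μ_natural,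
    twistedγ, twistedγ,
    ← tensorHom_comp_tensorHom (S.M.map (FTriv.toIso φ).inv ⊗ₘ 𝟙 _), Category.assoc,
    ← tensorμ_natural_assoc,
    ← H.interchange, tensorHom_comp_tensorHom_assoc, id_tensorHom_id, Category.id_comp,
    Category.comp_id]

/-- The units are invariant under the action, so the twist disappears. -/
lemma γUnit_twistedγ (H : S.IsMonoid) (h : o.γUnits = true) {X Y : FTriv} (φ : X ⟶ Y) :
    (S.γUnit h Y ⊗ₘ 𝟙 _) ≫ S.twistedγ φ = (λ_ _).hom := by
  rw [twistedγ, tensorHom_comp_tensorHom_assoc, H.γUnit_natural, Category.comp_id, tensorHom_id,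
    H.γUnit_left]

end IsMonoid

/-- The value on objects of the functor classifying a monoid object. -/
def evalObj (S : SymmSeqComponents o C) : NCPlus o FTriv → C
  | .of (X := X) _ => S.M.obj X
  | .empty => 𝟙_ C
  | .box A B => S.evalObj A ⊗ S.evalObj B

variable [SymmetricCategory C]

/-- The value on formal morphisms of the functor classifying a monoid object. -/
def evalHom (S : SymmSeqComponents o C) :
    {A B : NCPlus o FTriv} → NCPlus.Hom A B → (S.evalObj A ⟶ S.evalObj B)
  | _, _, .ident _ => 𝟙 _
  | _, _, .comp f g => S.evalHom f ≫ S.evalHom g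
  | _, _, .box f g => S.evalHom f ⊗ₘ S.evalHom g
  | _, _, .assoc A B D => (α_ (S.evalObj A) (S.evalObj B) (S.evalObj D)).hom
  | _, _, .assocInv A B D => (α_ (S.evalObj A) (S.evalObj B) (S.evalObj D)).inv
  | _, _, .left A => (λ_ (S.evalObj A)).hom
  | _, _, .leftInv A => (λ_ (S.evalObj A)).inv
  | _, _, .right A => (ρ_ (S.evalObj A)).hom
  | _, _, .rightInv A => (ρ_ (S.evalObj A)).inv
  | _, _, .swap A B => (β_ (S.evalObj A) (S.evalObj B)).hom
  -- The value of an object depends only on the source of `φ`, so the target permutation `σ'` plays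
  -- no part.
  | _, _, .iso _ _ σ _ _ => S.M.map σ.hom
  -- Only the inner morphism `φ₀` twists: it relates the source of `φ₁` to the source of the
  -- composite.
  | _, _, .γ _ φ₀ => S.twistedγ φ₀
  | _, _, .μ (X₁ := X₁) (X₂ := X₂) _ _ => S.μ X₁ X₂
  | _, _, .γUnit h X => S.γUnit h X
  | _, _, .μUnit h => S.μUnit h

lemma evalHom_ofEq (S : SymmSeqComponents o C) {X Y : FTriv} {φ ψ : X ⟶ Y} (h : φ = ψ) :
    S.evalHom (NCPlus.Hom.ofEq h) = 𝟙 (S.M.obj X) :=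
  S.M.map_id X

lemma evalHom_middle (S : SymmSeqComponents o C) (A B D E : NCPlus o FTriv) :
    S.evalHom (NCPlus.Hom.middle A B D E) =
      tensorμ (S.evalObj A) (S.evalObj B) (S.evalObj D) (S.evalObj E) := by
  simp only [tensorμ, ← id_tensorHom, ← tensorHom_id]
  rfl

/-- The congruence and symmetric monoidal relations hold in `C`. The remaining ones are the axioms
of `S`, in their twisted form wherever `γ` meets morphisms other than identities. -/
lemma IsMonoid.evalHom_eq {S : SymmSeqComponents o C} (H : S.IsMonoid) {A B : NCPlus o FTriv}
    {f g : NCPlus.Hom A B} (r : NCPlus.Rel f g) : S.evalHom f = S.evalHom g := by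
  induction r with
  | refl f => rfl
  | symm _ ih => exact ih.symm
  | trans _ _ ih ih' => exact ih.trans ih'
  | comp _ _ ih ih' => exact congrArg₂ (· ≫ ·) ih ih'
  | box _ _ ih ih' => exact congrArg₂ (· ⊗ₘ ·) ih ih'
  | id_comp f => exact Category.id_comp _
  | comp_id f => exact Category.comp_id _
  | comp_assoc f g h => exact Category.assoc _ _ _
  | box_id A B => exact id_tensorHom_id _ _
  | box_comp f f' g g' => exact tensorHom_comp_tensorHom _ _ _ _
  | assoc_assocInv A B D => exact Iso.hom_inv_id _
  | assocInv_assoc A B D => exact Iso.inv_hom_id _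
  | assoc_natural f g h => exact associator_naturality _ _ _
  | left_leftInv A => exact Iso.hom_inv_id _
  | leftInv_left A => exact Iso.inv_hom_id _
  | left_natural f =>
    exact (congrArg (· ≫ _) (id_tensorHom _ _)).trans (leftUnitor_naturality (S.evalHom f))
  | right_rightInv A => exact Iso.hom_inv_id _
  | rightInv_right A => exact Iso.inv_hom_id _
  | right_natural f =>
    exact (congrArg (· ≫ _) (tensorHom_id _ _)).trans (rightUnitor_naturality (S.evalHom f))
  | pentagon A B D E =>
    have h := MonoidalCategory.pentagon (S.evalObj A) (S.evalObj B) (S.evalObj D) (S.evalObj E)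
    -- Formal morphisms have `⊠`-products but no whiskerings, so whiskerings are written as products
    -- with identities. The same is done in later cases.
    simp only [← id_tensorHom, ← tensorHom_id] at h
    exact h
  | triangle A B =>
    have h := MonoidalCategory.triangle (S.evalObj A) (S.evalObj B)
    simp only [← id_tensorHom, ← tensorHom_id] at h
    exact h
  | swap_natural f g => exact BraidedCategory.braiding_naturality _ _
  | swap_swap A B => exact SymmetricCategory.symmetry _ _
  | hexagon A B D =>
    have h := BraidedCategory.hexagon_forward (S.evalObj A) (S.evalObj B) (S.evalObj D)
    simp only [← id_tensorHom, ← tensorHom_id] at h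
    exact h
  | iso_refl φ => exact S.M.map_id _
  | iso_trans => exact (S.M.map_comp _ _).symm
  | γ_equivariant φ₁ φ₀ ψ₁ ψ₀ σ τ σ' h₁ h₀ h => exact H.twistedγ_natural φ₀ ψ₀ σ.hom τ.hom h₀
  | γ_assoc φ₂ φ₁ φ₀ =>
    simp only [evalHom, evalHom_ofEq]
    refine (H.twistedγ_assoc φ₁ φ₀).trans ?_
    exact congrArg (fun f => _ ≫ _ ≫ f) (Category.comp_id _).symm
  | μ_equivariant φ₁ φ₂ ψ₁ ψ₂ σ₁ σ₁' σ₂ σ₂' h₁ h₂ h => exact H.μ_natural σ₁.hom σ₂.hom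
  | @μ_assoc X₁ _ X₂ _ X₃ _ φ₁ φ₂ φ₃ =>
    have h := H.μ_assoc X₁ X₂ X₃
    simp only [← id_tensorHom, ← tensorHom_id] at h
    exact h
  | interchange φ₁ φ₀ ψ₁ ψ₀ =>
    simp only [evalHom, evalHom_ofEq, evalHom_middle]
    refine Eq.trans ?_ (H.μ_twistedγ φ₀ ψ₀)
    exact congrArg (fun f => _ ≫ f) (Category.comp_id _)
  | @μ_symmetric h X₁ _ X₂ _ φ₁ φ₂ => exact H.commutative h X₁ X₂
  | γUnit_iso hu σ h => exact H.γUnit_natural hu σ.hom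
  | γUnit_left hu φ =>
    simp only [evalHom, evalHom_ofEq]
    refine Eq.trans ?_ (H.γUnit_twistedγ hu φ)
    exact congrArg (fun f => _ ≫ f) (Category.comp_id _)
  | @γUnit_right hu X Y φ =>
    have h := H.γUnit_right hu X
    rw [← id_tensorHom] at h
    -- For the right unit the inner morphism is an identity, so there is no twist, unlike for the
    -- left unit.
    simp only [evalHom, evalHom_ofEq, twistedγ_id]
    refine Eq.trans ?_ h
    exact congrArg (fun f => _ ≫ f) (Category.comp_id (S.γ X))
  | μ_γUnit hu X Y =>
    simp only [evalHom, evalHom_ofEq]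
    refine Eq.trans ?_ (H.μ_γUnit hu X Y)
    exact congrArg (fun f => _ ≫ f) (Category.comp_id _)
  | @μUnit_left hu X Y φ h =>
    have h := H.μUnit_left hu X
    rw [← tensorHom_id] at h
    exact h
  | @μUnit_right hu X Y φ h =>
    have h := H.μUnit_right hu X
    rw [← id_tensorHom] at h
    exact h
  | γ_μUnit hu =>
    simp only [evalHom, evalHom_ofEq, twistedγ_id]
    refine Eq.trans ?_ (H.γ_μUnit hu)
    exact congrArg (fun f => _ ≫ f) (Category.comp_id _)
  | μUnit_eq_γUnit hu hu' => exact H.μUnit_eq_γUnit hu hu'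

end SymmSeqComponents

/-! ### The functor classifying a monoid object -/

namespace SymmSeqComponents.IsMonoid

variable {o : NCPlusOptions} {C : Type u} [Category.{v} C] [MonoidalCategory C]
  [SymmetricCategory C] {S : SymmSeqComponents o C}

/-- The functor classifying a monoid object in symmetric sequences of monoids. -/
def evalFunctor (H : S.IsMonoid) : NCPlus o FTriv ⥤ C where
  obj := S.evalObj
  map {A B} := Quotient.lift (S.evalHom (A := A) (B := B)) fun _ _ r => H.evalHom_eq r
  map_id _ := rfl
  map_comp := by
    rintro _ _ _ ⟨f⟩ ⟨g⟩
    rfl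

lemma evalFunctor_map_tensorHom (H : S.IsMonoid) {A B A' B' : NCPlus o FTriv} (f : A ⟶ A')
    (g : B ⟶ B') : H.evalFunctor.map (f ⊗ₘ g) = H.evalFunctor.map f ⊗ₘ H.evalFunctor.map g := by
  obtain ⟨f⟩ := f
  obtain ⟨g⟩ := g
  rfl

/-- The classifying functor is strictly monoidal. -/
def evalFunctorCoreMonoidal (H : S.IsMonoid) : H.evalFunctor.CoreMonoidal where
  εIso := Iso.refl _
  μIso A B := Iso.refl _
  μIso_hom_natural_left f B := by
    refine (Category.comp_id _).trans (Eq.trans ?_ (Category.id_comp _).symm)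
    rw [← tensorHom_id, ← tensorHom_id, evalFunctor_map_tensorHom, H.evalFunctor.map_id]
  μIso_hom_natural_right A _ := by
    refine (Category.comp_id _).trans (Eq.trans ?_ (Category.id_comp _).symm)
    rw [← id_tensorHom, ← id_tensorHom, evalFunctor_map_tensorHom, H.evalFunctor.map_id]
  associativity A B D := by
    change 𝟙 (S.evalObj A ⊗ S.evalObj B) ▷ S.evalObj D ≫
        𝟙 ((S.evalObj A ⊗ S.evalObj B) ⊗ S.evalObj D) ≫ (α_ _ _ _).hom =
      (α_ _ _ _).hom ≫ S.evalObj A ◁ 𝟙 (S.evalObj B ⊗ S.evalObj D) ≫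
        𝟙 (S.evalObj A ⊗ S.evalObj B ⊗ S.evalObj D)
    simp
  left_unitality A := by
    change _ = 𝟙 (𝟙_ C) ▷ S.evalObj A ≫ 𝟙 (𝟙_ C ⊗ S.evalObj A) ≫ (λ_ (S.evalObj A)).hom
    rw [id_whiskerRight, Category.id_comp, Category.id_comp]
    rfl
  right_unitality A := by
    change _ = S.evalObj A ◁ 𝟙 (𝟙_ C) ≫ 𝟙 (S.evalObj A ⊗ 𝟙_ C) ≫ (ρ_ (S.evalObj A)).hom
    rw [whiskerLeft_id, Category.id_comp, Category.id_comp]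
    rfl

instance (H : S.IsMonoid) : H.evalFunctor.Braided where
  toMonoidal := H.evalFunctorCoreMonoidal.toMonoidal
  braided _ _ := (Category.id_comp _).trans (Category.comp_id _).symm

/-- This is an equality, not just an isomorphism: the classifying functor is strictly monoidal and
sends `id_X` to `M(X)` itself. -/
lemma mapLax_evalFunctor (H : S.IsMonoid) :
    (NCPlus.universalComponents o).mapLax H.evalFunctor = S := by
  have hγ (X : FTriv) : ((NCPlus.universalComponents o).mapLax H.evalFunctor).γ X = S.γ X := by
    change 𝟙 (S.M.obj X ⊗ S.M.obj X) ≫ S.twistedγ (𝟙 X) ≫ S.M.map (𝟙 X) = _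
    rw [twistedγ_id, S.M.map_id, Category.comp_id, Category.id_comp]
  have hμ (X Y : FTriv) :
      ((NCPlus.universalComponents o).mapLax H.evalFunctor).μ X Y = S.μ X Y := by
    change 𝟙 (S.M.obj X ⊗ S.M.obj Y) ≫ S.μ X Y ≫ S.M.map (𝟙 (X ⊗ Y)) = _
    rw [S.M.map_id, Category.comp_id, Category.id_comp]
  have hγUnit (h : o.γUnits = true) (X : FTriv) :
      ((NCPlus.universalComponents o).mapLax H.evalFunctor).γUnit h X = S.γUnit h X :=
    Category.id_comp _
  have hμUnit (h : o.μUnit = true) :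
      ((NCPlus.universalComponents o).mapLax H.evalFunctor).μUnit h = S.μUnit h :=
    Category.id_comp _
  obtain ⟨M, γ, γUnit, μ, μUnit⟩ := S
  -- The underlying symmetric sequences agree by definition, so the other fields can be compared
  -- without transport.
  exact congr (congr (congr (congrArg (SymmSeqComponents.mk M) (funext hγ))
    (funext fun h => funext (hγUnit h))) (funext fun X => funext (hμ X))) (funext hμUnit)

end SymmSeqComponents.IsMonoid

/-! ### Extending morphisms from the identities to all words -/

/-- Morphisms of symmetric sequences that respect the components of the structure maps. -/
structure SymmSeqComponents.IsHom {o : NCPlusOptions} {A : Type u} [Category.{v} A]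
    [MonoidalCategory A] (S T : SymmSeqComponents o A) (f : S.M ⟶ T.M) : Prop where
  γ_comp (X : FTriv) : S.γ X ≫ f.app X = (f.app X ⊗ₘ f.app X) ≫ T.γ X
  γUnit_comp (h : o.γUnits = true) (X : FTriv) : S.γUnit h X ≫ f.app X = T.γUnit h X
  μ_comp (X Y : FTriv) : S.μ X Y ≫ f.app (X ⊗ Y) = (f.app X ⊗ₘ f.app Y) ≫ T.μ X Y
  μUnit_comp (h : o.μUnit = true) : S.μUnit h ≫ f.app (𝟙_ FTriv) = T.μUnit h

namespace NCPlus

variable {o : NCPlusOptions}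

/-- Invertibility of `φ` forces `σ'` to be the identity as soon as `σ` is. -/
lemma isoHom_eq_id {X Y : FTriv} (φ : X ⟶ Y) (σ : X ≅ X) (σ' : Y ≅ Y)
    (h : φ ≫ σ'.hom = σ.hom ≫ φ) (hσ : σ.hom = 𝟙 X) :
    (isoHom φ φ σ σ' h : (of φ : NCPlus o FTriv) ⟶ _) = 𝟙 _ := by
  obtain rfl : σ = Iso.refl X := Iso.ext hσ
  have hσ' : σ'.hom = 𝟙 Y := by
    have h₁ := (FTriv.toIso φ).inv ≫= h
    rw [Iso.refl_hom, Category.id_comp, FTriv.toIso_inv_hom, ← Category.assoc,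
      FTriv.toIso_inv_hom, Category.id_comp] at h₁
    exact h₁
  obtain rfl : σ' = Iso.refl Y := Iso.ext hσ'
  exact eqHom_rfl φ

/-- Every morphism of `FTriv` is isomorphic to an identity. -/
def isoId {X Y : FTriv} (φ : X ⟶ Y) : (of φ : NCPlus o FTriv) ≅ of (𝟙 X) where
  hom := isoHom φ (𝟙 X) (Iso.refl X) (FTriv.toIso φ).symm
    (by rw [Iso.symm_hom, Iso.refl_hom, Category.id_comp, FTriv.hom_toIso_inv])
  inv := isoHom (𝟙 X) φ (Iso.refl X) (FTriv.toIso φ)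
    (by rw [Iso.refl_hom, FTriv.toIso_hom])
  hom_inv_id := by
    rw [isoHom_comp]
    exact isoHom_eq_id _ _ _ _ (Category.comp_id _)
  inv_hom_id := by
    rw [isoHom_comp]
    exact isoHom_eq_id _ _ _ _ (Category.comp_id _)

lemma isoId_id_hom (X : FTriv) : (isoId (𝟙 X) : (of (𝟙 X) : NCPlus o FTriv) ≅ _).hom = 𝟙 _ :=
  isoHom_eq_id _ _ _ _ rfl

lemma isoId_id_inv (X : FTriv) : (isoId (𝟙 X) : (of (𝟙 X) : NCPlus o FTriv) ≅ _).inv = 𝟙 _ :=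
  isoHom_eq_id _ _ _ _ rfl

/-- Conjugation to identities replaces `σ'` by `φ ≫ σ' ≫ ψ⁻¹`, which equals `σ`. -/
lemma isoHom_eq {X Y X' Y' : FTriv} (φ : X ⟶ Y) (ψ : X' ⟶ Y') (σ : X ≅ X') (σ' : Y ≅ Y')
    (h : φ ≫ σ'.hom = σ.hom ≫ ψ) :
    (isoHom φ ψ σ σ' h : (of φ : NCPlus o FTriv) ⟶ _) =
      (isoId φ).hom ≫ idMap σ ≫ (isoId ψ).inv := by
  rw [← Category.assoc, Iso.eq_comp_inv, ← Iso.inv_comp_eq]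
  simp only [isoId, idMap, isoHom_comp]
  have hσ : Iso.refl X ≪≫ σ ≪≫ Iso.refl X' = σ := by simp
  have hσ' : FTriv.toIso φ ≪≫ σ' ≪≫ (FTriv.toIso ψ).symm = σ := by
    ext1
    change φ ≫ σ'.hom ≫ (FTriv.toIso ψ).inv = _
    rw [reassoc_of% h, FTriv.hom_toIso_inv, Category.comp_id]
  congr 1

/-- Equivariance of `γ`, used to turn both factors into `id_X`. For this `φ₁` is moved by `(φ₀⁻¹ ⇓
(φ₀ ≫ φ₁)⁻¹)`; using `isoId φ₁` would lead to `id_Y` instead. This is the source of the twist in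
`twistedγ`. -/
lemma gammaHom_eq {X Y Z : FTriv} (φ₁ : Y ⟶ Z) (φ₀ : X ⟶ Y) :
    (gammaHom φ₁ φ₀ : (of φ₁ ⊗ of φ₀ : NCPlus o FTriv) ⟶ _) =
      (isoHom φ₁ (𝟙 X) (FTriv.toIso φ₀).symm (FTriv.toIso (φ₀ ≫ φ₁)).symm
          (by
            rw [Iso.symm_hom, Iso.symm_hom, FTriv.toIso_comp_inv, ← Category.assoc,
              FTriv.hom_toIso_inv, Category.id_comp, Category.comp_id]) ⊗ₘ
        (isoId φ₀).hom) ≫ idGamma X ≫ (isoId (φ₀ ≫ φ₁)).inv := by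
  simp only [isoId, idGamma, Category.assoc, reassoc_of% @gammaHom_natural,
    eqHom_isoHom, isoHom_comp]
  rw [isoHom_eq_id _ _ _ _ (Category.comp_id _), Category.comp_id]

lemma muHom_eq {X₁ Y₁ X₂ Y₂ : FTriv} (φ₁ : X₁ ⟶ Y₁) (φ₂ : X₂ ⟶ Y₂) :
    (muHom φ₁ φ₂ : (of φ₁ ⊗ of φ₂ : NCPlus o FTriv) ⟶ _) =
      ((isoId φ₁).hom ⊗ₘ (isoId φ₂).hom) ≫ idMu X₁ X₂ ≫ (isoId (φ₁ ⊗ₘ φ₂)).inv := by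
  simp only [isoId, idMu, Category.assoc, reassoc_of% @muHom_natural,
    eqHom_isoHom, isoHom_comp]
  rw [isoHom_eq_id, Category.comp_id]
  simp

section Extension

/-- The value at `id_X` of a morphism of symmetric sequences. -/
def idApp {C : Type u} [Category.{v} C] {F G : NCPlus o FTriv ⥤ C}
    (f : idFunctor o ⋙ F ⟶ idFunctor o ⋙ G) (X : FTriv) :
    F.obj (of (𝟙 X)) ⟶ G.obj (of (𝟙 X)) :=
  f.app X

lemma map_idMap_idApp {C : Type u} [Category.{v} C] {F G : NCPlus o FTriv ⥤ C}
    (f : idFunctor o ⋙ F ⟶ idFunctor o ⋙ G) {X Y : FTriv} (σ : X ≅ Y) :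
    F.map (idMap σ) ≫ idApp f Y = idApp f X ≫ G.map (idMap σ) := by
  have hσ : FTriv.toIso σ.hom = σ := Iso.ext rfl
  have h : F.map (idMap (FTriv.toIso σ.hom)) ≫ idApp f Y =
    idApp f X ≫ G.map (idMap (FTriv.toIso σ.hom)) := f.naturality σ.hom
  rwa [hσ] at h

open Functor.LaxMonoidal Functor.OplaxMonoidal

variable {C : Type u} [Category.{v} C] [MonoidalCategory C] [SymmetricCategory C]
  {F G : NCPlus o FTriv ⥤ C} [F.Braided] [G.Braided]

/-- A family of morphisms given on the objects `id_X` extends to all words. -/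
def extendApp (f : idFunctor o ⋙ F ⟶ idFunctor o ⋙ G) : ∀ A, F.obj A ⟶ G.obj A
  | .of (X := X) φ => F.map (isoId φ).hom ≫ idApp f X ≫ G.map (isoId φ).inv
  | .empty => η F ≫ ε G
  | .box A B => δ F A B ≫ (extendApp f A ⊗ₘ extendApp f B) ≫ Functor.LaxMonoidal.μ G A B

variable (f : idFunctor o ⋙ F ⟶ idFunctor o ⋙ G)

lemma extendApp_of {X Y : FTriv} (φ : X ⟶ Y) :
    extendApp f (of φ) = F.map (isoId φ).hom ≫ idApp f X ≫ G.map (isoId φ).inv := rfl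

lemma extendApp_id (X : FTriv) : extendApp f (of (𝟙 X)) = idApp f X := by
  rw [extendApp_of, isoId_id_hom, isoId_id_inv, F.map_id, G.map_id, Category.id_comp,
    Category.comp_id]

lemma extendApp_unit : extendApp f (𝟙_ (NCPlus o FTriv)) = η F ≫ ε G := rfl

lemma extendApp_tensor (A B : NCPlus o FTriv) : extendApp f (A ⊗ B) =
    δ F A B ≫ (extendApp f A ⊗ₘ extendApp f B) ≫ Functor.LaxMonoidal.μ G A B := rfl

lemma extendApp_natural_tensor {A B A' B' : NCPlus o FTriv} {g : A ⟶ A'} {h : B ⟶ B'}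
    (hg : F.map g ≫ extendApp f A' = extendApp f A ≫ G.map g)
    (hh : F.map h ≫ extendApp f B' = extendApp f B ≫ G.map h) :
    F.map (g ⊗ₘ h) ≫ extendApp f (A' ⊗ B') = extendApp f (A ⊗ B) ≫ G.map (g ⊗ₘ h) := by
  simp only [extendApp_tensor, Category.assoc, ← δ_natural_assoc, ← μ_natural,
    tensorHom_comp_tensorHom_assoc, hg, hh]

/-- The associators of `F` and `G` are expressed through those of `C`, and the resulting composites
of `μ` with `δ` cancel because both functors are strong. -/
lemma extendApp_natural_associator (A B D : NCPlus o FTriv) :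
    F.map (α_ A B D).hom ≫ extendApp f (A ⊗ B ⊗ D) =
      extendApp f ((A ⊗ B) ⊗ D) ≫ G.map (α_ A B D).hom := by
  rw [Functor.Monoidal.map_associator, Functor.Monoidal.map_associator]
  simp only [extendApp_tensor, Category.assoc, Functor.Monoidal.μ_δ_assoc, ← id_tensorHom,
    ← tensorHom_id, tensorHom_comp_tensorHom_assoc, Category.id_comp, Category.comp_id,
    Functor.Monoidal.μ_δ]
  -- The inserted identity lets `δ F A B` be split off from a product and aligned with the other
  -- side.
  rw [← Category.id_comp (extendApp f D), ← tensorHom_comp_tensorHom (δ F A B)]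
  simp only [Category.id_comp, Category.assoc, associator_naturality_assoc,
    tensorHom_comp_tensorHom_assoc, Category.comp_id]

lemma extendApp_natural_leftUnitor (A : NCPlus o FTriv) :
    F.map (λ_ A).hom ≫ extendApp f A = extendApp f (𝟙_ _ ⊗ A) ≫ G.map (λ_ A).hom := by
  rw [Functor.Monoidal.map_leftUnitor, Functor.Monoidal.map_leftUnitor]
  simp only [extendApp_tensor, extendApp_unit, Category.assoc, Functor.Monoidal.μ_δ_assoc,
    ← leftUnitor_naturality, ← id_tensorHom, ← tensorHom_id, tensorHom_comp_tensorHom_assoc,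
    Category.id_comp, Category.comp_id, Functor.Monoidal.ε_η]

lemma extendApp_natural_rightUnitor (A : NCPlus o FTriv) :
    F.map (ρ_ A).hom ≫ extendApp f A = extendApp f (A ⊗ 𝟙_ _) ≫ G.map (ρ_ A).hom := by
  rw [Functor.Monoidal.map_rightUnitor, Functor.Monoidal.map_rightUnitor]
  simp only [extendApp_tensor, extendApp_unit, Category.assoc, Functor.Monoidal.μ_δ_assoc,
    ← rightUnitor_naturality, ← id_tensorHom, ← tensorHom_id, tensorHom_comp_tensorHom_assoc,
    Category.id_comp, Category.comp_id, Functor.Monoidal.ε_η]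

lemma extendApp_natural_braiding (A B : NCPlus o FTriv) :
    F.map (β_ A B).hom ≫ extendApp f (B ⊗ A) = extendApp f (A ⊗ B) ≫ G.map (β_ A B).hom := by
  simp only [extendApp_tensor, Functor.map_braiding, Category.assoc,
    Functor.Monoidal.μ_δ_assoc, BraidedCategory.braiding_naturality_assoc]

lemma extendApp_natural_isoHom {X Y X' Y' : FTriv} (φ : X ⟶ Y) (ψ : X' ⟶ Y') (σ : X ≅ X')
    (σ' : Y ≅ Y') (h : φ ≫ σ'.hom = σ.hom ≫ ψ) :
    F.map (isoHom φ ψ σ σ' h) ≫ extendApp f (of ψ) =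
      extendApp f (of φ) ≫ G.map (isoHom φ ψ σ σ' h) := by
  simp only [isoHom_eq, extendApp_of, Functor.map_comp, Category.assoc,
    Iso.map_inv_hom_id_assoc, reassoc_of% @map_idMap_idApp]

variable {f}

/-- Precomposition with the invertible `μ` of `F` cancels the `δ` in the extension and leaves the
hypothesis on `γ`. The other structure maps are treated likewise, with `ε` and `η` for the units. -/
lemma extendApp_natural_idGamma
    (hf : ((universalComponents o).mapLax F).IsHom ((universalComponents o).mapLax G) f)
    (X : FTriv) :
    F.map (idGamma X) ≫ extendApp f (of (𝟙 X)) =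
      extendApp f (of (𝟙 X) ⊗ of (𝟙 X)) ≫ G.map (idGamma X) := by
  have h : (Functor.LaxMonoidal.μ F _ _ ≫ F.map (idGamma X)) ≫ idApp f X =
    (idApp f X ⊗ₘ idApp f X) ≫ Functor.LaxMonoidal.μ G _ _ ≫ G.map (idGamma X) := hf.γ_comp X
  rw [← cancel_epi (Functor.LaxMonoidal.μ F _ _), extendApp_tensor, extendApp_id,
    Category.assoc, Category.assoc, Functor.Monoidal.μ_δ_assoc, ← h, Category.assoc]

lemma extendApp_natural_idMu
    (hf : ((universalComponents o).mapLax F).IsHom ((universalComponents o).mapLax G) f)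
    (X Y : FTriv) :
    F.map (idMu X Y) ≫ extendApp f (of (𝟙 (X ⊗ Y))) =
      extendApp f (of (𝟙 X) ⊗ of (𝟙 Y)) ≫ G.map (idMu X Y) := by
  have h : (Functor.LaxMonoidal.μ F _ _ ≫ F.map (idMu X Y)) ≫ idApp f (X ⊗ Y) =
    (idApp f X ⊗ₘ idApp f Y) ≫ Functor.LaxMonoidal.μ G _ _ ≫ G.map (idMu X Y) := hf.μ_comp X Y
  rw [← cancel_epi (Functor.LaxMonoidal.μ F _ _), extendApp_tensor, extendApp_id, extendApp_id,
    extendApp_id, Category.assoc, Category.assoc, Functor.Monoidal.μ_δ_assoc, ← h,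
    Category.assoc]

lemma extendApp_natural_gammaUnitHom
    (hf : ((universalComponents o).mapLax F).IsHom ((universalComponents o).mapLax G) f)
    (hu : o.γUnits = true) (X : FTriv) :
    F.map (gammaUnitHom hu X) ≫ extendApp f (of (𝟙 X)) =
      extendApp f (𝟙_ (NCPlus o FTriv)) ≫ G.map (gammaUnitHom hu X) := by
  have h : (ε F ≫ F.map (gammaUnitHom hu X)) ≫ idApp f X = ε G ≫ G.map (gammaUnitHom hu X) :=
    hf.γUnit_comp hu X
  rw [← cancel_epi (ε F), extendApp_id, extendApp_unit, Category.assoc,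
    Functor.Monoidal.ε_η_assoc, ← h, Category.assoc]

lemma extendApp_natural_muUnitHom
    (hf : ((universalComponents o).mapLax F).IsHom ((universalComponents o).mapLax G) f)
    (hu : o.μUnit = true) :
    F.map (muUnitHom hu) ≫ extendApp f (of (𝟙 (𝟙_ FTriv))) =
      extendApp f (𝟙_ (NCPlus o FTriv)) ≫ G.map (muUnitHom hu) := by
  have h : (ε F ≫ F.map (muUnitHom hu)) ≫ idApp f (𝟙_ FTriv) = ε G ≫ G.map (muUnitHom hu) :=
    hf.μUnit_comp hu
  rw [← cancel_epi (ε F), extendApp_id, extendApp_unit, Category.assoc,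
    Functor.Monoidal.ε_η_assoc, ← h, Category.assoc]

lemma extendApp_natural_mk
    (hf : ((universalComponents o).mapLax F).IsHom ((universalComponents o).mapLax G) f)
    {A B : NCPlus o FTriv} (g : Hom A B) :
    MorphismProperty.naturalityProperty (extendApp f) (mk g) := by
  -- The morphisms at which a family is natural are closed under composition and under inverses of
  -- isomorphisms, so induction on formal morphisms leaves only the generators.
  have comp {A B D : NCPlus o FTriv} {g : A ⟶ B} {h : B ⟶ D}
      (hg : MorphismProperty.naturalityProperty (extendApp f) g)
      (hh : MorphismProperty.naturalityProperty (extendApp f) h) :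
      MorphismProperty.naturalityProperty (extendApp f) (g ≫ h) :=
    MorphismProperty.comp_mem _ g h hg hh
  have symm {A B : NCPlus o FTriv} (e : A ≅ B)
      (he : MorphismProperty.naturalityProperty (extendApp f) e.hom) :
      MorphismProperty.naturalityProperty (extendApp f) e.inv :=
    MorphismProperty.naturalityProperty.stableUnderInverse _ e he
  have hiso {X Y X' Y' : FTriv} (φ : X ⟶ Y) (ψ : X' ⟶ Y') (σ : X ≅ X') (σ' : Y ≅ Y')
      (h : φ ≫ σ'.hom = σ.hom ≫ ψ) :
      MorphismProperty.naturalityProperty (extendApp f) (isoHom φ ψ σ σ' h) :=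
    extendApp_natural_isoHom f φ ψ σ σ' h
  induction g with
  | ident A => exact MorphismProperty.id_mem _ A
  | comp _ _ ih ih' => exact comp ih ih'
  | box _ _ ih ih' => exact extendApp_natural_tensor f ih ih'
  | assoc A B D => exact extendApp_natural_associator f A B D
  | assocInv A B D => exact symm (α_ A B D) (extendApp_natural_associator f A B D)
  | left A => exact extendApp_natural_leftUnitor f A
  | leftInv A => exact symm (λ_ A) (extendApp_natural_leftUnitor f A)
  | right A => exact extendApp_natural_rightUnitor f A
  | rightInv A => exact symm (ρ_ A) (extendApp_natural_rightUnitor f A)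
  | swap A B => exact extendApp_natural_braiding f A B
  | iso φ ψ σ σ' h => exact hiso φ ψ σ σ' h
  | γ φ₁ φ₀ =>
    change MorphismProperty.naturalityProperty (extendApp f) (gammaHom φ₁ φ₀)
    rw [gammaHom_eq]
    exact comp (extendApp_natural_tensor f (hiso _ _ _ _ _) (hiso _ _ _ _ _))
      (comp (extendApp_natural_idGamma hf _) (hiso _ _ _ _ _))
  | μ φ₁ φ₂ =>
    change MorphismProperty.naturalityProperty (extendApp f) (muHom φ₁ φ₂)
    rw [muHom_eq]
    exact comp (extendApp_natural_tensor f (hiso _ _ _ _ _) (hiso _ _ _ _ _))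
      (comp (extendApp_natural_idMu hf _ _) (hiso _ _ _ _ _))
  | γUnit h X => exact extendApp_natural_gammaUnitHom hf h X
  | μUnit h => exact extendApp_natural_muUnitHom hf h

lemma extendApp_natural
    (hf : ((universalComponents o).mapLax F).IsHom ((universalComponents o).mapLax G) f)
    {A B : NCPlus o FTriv} (g : A ⟶ B) :
    F.map g ≫ extendApp f B = extendApp f A ≫ G.map g := by
  obtain ⟨g⟩ := g
  exact extendApp_natural_mk hf g

/-- The monoidal natural transformation that extends a morphism of symmetric sequences. -/
def extend (hf : ((universalComponents o).mapLax F).IsHom ((universalComponents o).mapLax G) f) :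
    F ⟶ G where
  app := extendApp f
  naturality _ _ g := extendApp_natural hf g

lemma isMonoidal_extend
    (hf : ((universalComponents o).mapLax F).IsHom ((universalComponents o).mapLax G) f) :
    NatTrans.IsMonoidal (extend hf) where
  unit := by
    change ε F ≫ η F ≫ ε G = ε G
    rw [Functor.Monoidal.ε_η_assoc]
  tensor A B := by
    change Functor.LaxMonoidal.μ F A B ≫ δ F A B ≫
      (extendApp f A ⊗ₘ extendApp f B) ≫ Functor.LaxMonoidal.μ G A B = _
    rw [Functor.Monoidal.μ_δ_assoc]
    rfl

/-- A monoidal natural transformation is determined by its values on the objects `id_X`. -/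
lemma natTrans_ext (a b : F ⟶ G) [NatTrans.IsMonoidal a] [NatTrans.IsMonoidal b]
    (h : ∀ X : FTriv, a.app (of (𝟙 X)) = b.app (of (𝟙 X))) : a = b := by
  ext A
  induction A with
  | of φ =>
    rw [← cancel_mono (G.map (isoId φ).hom), ← a.naturality, ← b.naturality, h]
  | empty =>
    exact (cancel_epi (ε F)).mp
      ((NatTrans.IsMonoidal.unit (τ := a)).trans (NatTrans.IsMonoidal.unit (τ := b)).symm)
  | box A B ihA ihB =>
    refine (cancel_epi (Functor.LaxMonoidal.μ F A B)).mp ?_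
    refine (NatTrans.IsMonoidal.tensor (τ := a) A B).trans
      (Eq.trans ?_ (NatTrans.IsMonoidal.tensor (τ := b) A B).symm)
    rw [ihA, ihB]

end Extension

end NCPlus

/-! ### Assembling the equivalence -/

section Equivalence

open GradedObject

variable {o : NCPlusOptions} {C : Type u} [Category.{v} C] [MonoidalCategory C]
  [SymmetricCategory C] [HasFiniteCoproducts C]
  [∀ X : C, PreservesFiniteCoproducts (tensorLeft X)]

namespace SymmSeqData

lemma Hom.isHom_components {D E : SymmSeqData o C} (g : D ⟶ E) :
    D.components.IsHom E.components g.f where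
  γ_comp X := g.γ_comp X.len
  γUnit_comp h X := g.γUnit_comp h X.len
  μ_comp X Y := by
    have h₁ : D.mul (X.len + Y.len) ≫ g.f.app ⟨X.len + Y.len⟩ =
        (SymmSeq.gradedMap g.f ⊗ₘ SymmSeq.gradedMap g.f) (X.len + Y.len) ≫
          E.mul (X.len + Y.len) := congrFun g.mul_comp (X.len + Y.len)
    have h₂ : Monoidal.ιTensorObj D.M.graded D.M.graded X.len Y.len (X.len + Y.len) rfl ≫
        (SymmSeq.gradedMap g.f ⊗ₘ SymmSeq.gradedMap g.f) (X.len + Y.len) =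
      (g.f.app X ⊗ₘ g.f.app Y) ≫
        Monoidal.ιTensorObj E.M.graded E.M.graded X.len Y.len (X.len + Y.len) rfl :=
      Monoidal.ι_tensorHom (SymmSeq.gradedMap g.f) (SymmSeq.gradedMap g.f) X.len Y.len _ rfl
    refine (Category.assoc _ _ _).trans ?_
    refine (congrArg (Monoidal.ιTensorObj D.M.graded D.M.graded X.len Y.len _ rfl ≫ ·) h₁).trans ?_
    refine (Category.assoc _ _ _).symm.trans ?_
    exact (congrArg (· ≫ E.mul (X.len + Y.len)) h₂).trans (Category.assoc _ _ _)
  μUnit_comp h :=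
    (Category.assoc _ _ _).trans
      (congrArg (Monoidal.tensorUnit₀.inv ≫ ·) (congrFun (g.one_comp h) 0))

/-- With `one_eq_gradedOne`, where the unit is initial outside degree `0`, this shows that graded
structure maps are recovered from their components. Structures may thus be compared by components.
-/
lemma mul_eq_gradedMul (D : SymmSeqData o C) : D.mul = D.M.gradedMul D.μ := by
  funext n
  refine Monoidal.tensorObj_ext _ _ fun p q h => ?_
  subst h
  exact (SymmSeq.ι_gradedMul D.M D.μ p q).symm

lemma one_eq_gradedOne (D : SymmSeqData o C) (h : o.μUnit = true) :
    D.one h = D.M.gradedOne (D.η h) := by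
  funext n
  cases n with
  | zero => exact (Iso.hom_inv_id_assoc Monoidal.tensorUnit₀ (D.one h 0)).symm
  | succ n => exact (Monoidal.isInitialTensorUnitApply (n + 1) n.succ_ne_zero).hom_ext _ _

/-- The structure maps assembled from given components. -/
def ofComponents (S : SymmSeqComponents o C) : SymmSeqData o C where
  M := S.M
  γ n := S.γ ⟨n⟩
  γUnit h n := S.γUnit h ⟨n⟩
  mul := SymmSeq.gradedMul S.M fun p q => S.μ ⟨p⟩ ⟨q⟩
  one h := SymmSeq.gradedOne S.M (S.μUnit h)

lemma ofComponents_components (D : SymmSeqData o C) : ofComponents D.components = D :=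
  congr (congrArg (SymmSeqData.mk D.M D.γ D.γUnit) D.mul_eq_gradedMul.symm)
    (funext fun h => (D.one_eq_gradedOne h).symm)

lemma components_injective :
    Function.Injective (components : SymmSeqData o C → SymmSeqComponents o C) :=
  Function.LeftInverse.injective ofComponents_components

end SymmSeqData

lemma components_symmSeqOfFunctor_μ (O : StrongSymmFunctor (NCPlus o FTriv) C) (X Y : FTriv) :
    ((symmSeqOfFunctor o C).obj O).components.μ X Y =
      ((NCPlus.universalComponents o).mapLax O.functor).μ X Y :=
  SymmSeq.ι_gradedMul (NCPlus.idFunctor o ⋙ O.functor)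
    (fun p q => Functor.LaxMonoidal.μ O.functor _ _ ≫ O.functor.map (NCPlus.mu o p q))
    X.len Y.len

lemma components_symmSeqOfFunctor_μUnit (O : StrongSymmFunctor (NCPlus o FTriv) C)
    (h : o.μUnit = true) :
    ((symmSeqOfFunctor o C).obj O).components.μUnit h =
      ((NCPlus.universalComponents o).mapLax O.functor).μUnit h :=
  Iso.inv_hom_id_assoc Monoidal.tensorUnit₀ _

/-- This identifies `M_O` with the image of the universal monoid object, so statements about
components apply to it. -/
lemma components_symmSeqOfFunctor (O : StrongSymmFunctor (NCPlus o FTriv) C) :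
    ((symmSeqOfFunctor o C).obj O).components =
      (NCPlus.universalComponents o).mapLax O.functor :=
  congr (congrArg (SymmSeqComponents.mk _ _ _)
      (funext fun X => funext (components_symmSeqOfFunctor_μ O X)))
    (funext (components_symmSeqOfFunctor_μUnit O))

lemma isMonoid_symmSeqOfFunctor (O : StrongSymmFunctor (NCPlus o FTriv) C) :
    SymmSeqData.isMonoid ((symmSeqOfFunctor o C).obj O) := by
  refine (SymmSeqData.isMonoid_iff_components _).mpr ?_
  rw [components_symmSeqOfFunctor]
  exact (NCPlus.isMonoid_universalComponents o).mapLax O.functor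

lemma isHom_mapLax {O P : StrongSymmFunctor (NCPlus o FTriv) C}
    (g : (symmSeqOfFunctor o C).obj O ⟶ (symmSeqOfFunctor o C).obj P) :
    ((NCPlus.universalComponents o).mapLax O.functor).IsHom
      ((NCPlus.universalComponents o).mapLax P.functor) g.f where
  γ_comp X := g.isHom_components.γ_comp X
  γUnit_comp h X := g.isHom_components.γUnit_comp h X
  μ_comp X Y := by
    rw [← components_symmSeqOfFunctor_μ, ← components_symmSeqOfFunctor_μ]
    exact g.isHom_components.μ_comp X Y
  μUnit_comp h := by
    rw [← components_symmSeqOfFunctor_μUnit, ← components_symmSeqOfFunctor_μUnit]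
    exact g.isHom_components.μUnit_comp h

instance : (symmSeqOfFunctor o C).Faithful where
  map_injective {O P} a b h := by
    refine StrongSymmFunctor.Hom.ext (NCPlus.natTrans_ext _ _ fun X => ?_)
    exact congrArg (fun g => (SymmSeqData.Hom.f g).app X) h

instance : (symmSeqOfFunctor o C).Full where
  map_surjective {O P} g := by
    -- The preimage of `g` is its extension to all words, which restricts to `g` on the identities.
    refine ⟨⟨NCPlus.extend (isHom_mapLax g),
      NCPlus.isMonoidal_extend (isHom_mapLax g)⟩, ?_⟩
    refine SymmSeqData.Hom.ext (NatTrans.ext (funext fun X => ?_))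
    exact NCPlus.extendApp_id g.f X

/-- The classifying functor of `D` is a strict preimage, because it has the same components as `D`
and these determine the structure. -/
lemma exists_symmSeqOfFunctor_obj_eq (D : SymmSeqData o C) (hD : D.IsMonoid) :
    ∃ O, (symmSeqOfFunctor o C).obj O = D := by
  have H := D.isMonoid_iff_components.mp hD
  refine ⟨⟨H.evalFunctor, inferInstance⟩, SymmSeqData.components_injective ?_⟩
  rw [components_symmSeqOfFunctor]
  exact H.mapLax_evalFunctor

end Equivalence

end

theorem mainTheorem4 (o : NCPlusOptions) (C : Type u) [Category.{v} C] [MonoidalCategory C]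
    [SymmetricCategory C] [HasFiniteCoproducts C]
    [∀ X : C, PreservesFiniteCoproducts (tensorLeft X)] :
    ∃ h : ∀ O : StrongSymmFunctor (NCPlus o FTriv) C,
        SymmSeqData.isMonoid ((symmSeqOfFunctor o C).obj O),
      (SymmSeqData.isMonoid.lift (symmSeqOfFunctor o C) h).IsEquivalence := by
  refine ⟨isMonoid_symmSeqOfFunctor, ?_⟩
  have : (SymmSeqData.isMonoid.lift (symmSeqOfFunctor o C)
      isMonoid_symmSeqOfFunctor).EssSurj := by
    refine ⟨fun D => ?_⟩
    obtain ⟨O, hO⟩ := exists_symmSeqOfFunctor_obj_eq D.obj D.property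
    exact ⟨O, ⟨SymmSeqData.isMonoid.isoMk (eqToIso hO)⟩⟩
  -- Fullness and faithfulness of the lift are inherited from `symmSeqOfFunctor`, as its target is a
  -- full subcategory.
  exact { }
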